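/- Let $q\ge 2$ and $r\ge 1$ be integers, and let $\mathcal F$ be the planar forest consisting of $r$ planar rooted trees $T_1,\dots,T_r$ in which every vertex has exactly $q$ linearly ordered children. Its boundary $\partial\mathcal F$, the disjoint union of the spaces of ends of the $T_i$, is identified with $\{1,\dots,r\}\times\{1,\dots,q\}^{\mathbb N}$ with the product topology. Order the vertices of $\mathcal F$ first by the tree in which they lie and then lexicographically by the path from the root. A \emph{finite subforest} is a choice, in each $T_i$, of a finite subtree $F_i$ containing the root of $T_i$ such that every vertex of $F_i$ has either all or none of its $q$ children in $F_i$; removing the edges and internal vertices of the $F_i$ leaves a planar forest $\mathcal F\setminus\bigcup F_i$ whose trees are rooted at the leaves of the $F_i$. Given finite subforests $(F_i)$ and $(F_i')$ such that $\mathcal F_1=\mathcal F\setminus\bigcup F_i$ and $\mathcal F_2=\mathcal F\setminus\bigcup F_i'$ have the same number $n$ of trees, every bijection between the trees of $\mathcal F_1$ and the trees of $\mathcal F_2$ is realized by a unique isomorphism of planar forests $\phi\colon\mathcal F_1\to\mathcal F_2$, which induces a homeomorphism $\phi_*$ of $\partial\mathcal F$; one calls $\phi$ a representative of $\phi_*$.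 Numbering the trees of $\mathcal F_1$ and of $\mathcal F_2$ in the order of their roots, $\phi$ determines a permutation $\sigma_\phi\in S_n$. The Higman--Thompson group $G_{q,r}$ is the group of all homeomorphisms of $\partial\mathcal F$ of the form $\phi_*$. Then there is a unique homomorphism $\theta\colon G_{q,r}\to\{1,-1\}\cong\mathbb Z/2\mathbb Z$ such that $\theta$ is trivial if $q$ is even, and $\theta(\phi_*)=\operatorname{sgn}\sigma_\phi$ for every representative $\phi$ if $q$ is odd. The commutator subgroup $G_{q,r}'$ of $G_{q,r}$ is equal to $\ker\theta$, and $G_{q,r}'$ is a simple group. -/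

import Mathlib

namespace HigmanThompson

/-- The vertices of the planar forest consisting of `r` planar rooted `q`-regular trees: a vertex is
given by the tree it lies in and by the word of the choices of children along the path from the
root of that tree. The children of `v` are the vertices `v.extend [a]` with `a : Fin q`, in the
order of `Fin q`, and the root of the tree number `i` is `⟨i, []⟩`. -/
@[ext]
structure Vertex (q r : ℕ) where
  tree : Fin r
  path : List (Fin q)

variable {q r : ℕ}

/-- The linear order on the vertices: first by the tree, then lexicographically by the path from
the root. -/
instance : LinearOrder (Vertex q r) :=
  LinearOrder.lift' (fun v => toLex (v.tree, v.path)) (by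
    intro v w h
    have h' := toLex.injective h
    rw [Prod.mk.injEq] at h'
    exact Vertex.ext h'.1 h'.2)

/-- The descendant of `v` reached from `v` by following the word `m`. -/
def Vertex.extend (v : Vertex q r) (m : List (Fin q)) : Vertex q r := ⟨v.tree, v.path ++ m⟩

/-- The infinite word obtained by putting the finite word `l` in front of `w`. -/
def prepend : List (Fin q) → (ℕ → Fin q) → ℕ → Fin q
  | [], w, n => w n
  | a :: _, _, 0 => a
  | _ :: l, w, n + 1 => prepend l w n

/-- The boundary of the forest, that is, the disjoint union of the boundaries of its `r` trees,
an end of a tree being identified with the unique ray from the root that represents it. It carries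
the product topology (all finite factors being discrete), which is the topology of the
visual metrics. -/
abbrev Boundary (q r : ℕ) : Type := Fin r × (ℕ → Fin q)

/-- The end represented by the ray that starts at the vertex `v` and then follows `w`. -/
def Vertex.ray (v : Vertex q r) (w : ℕ → Fin q) : Boundary q r := (v.tree, prepend v.path w)

/-- A choice, in each of the `r` trees, of a finite rooted regular subtree with the same root:
each vertex of the subtree has either all or none of its children in the subtree. -/
structure FiniteSubforest (q r : ℕ) where
  verts : Finset (Vertex q r)
  root_mem : ∀ i : Fin r, ⟨i, []⟩ ∈ verts
  parent_mem : ∀ (v : Vertex q r) (a : Fin q), v.extend [a] ∈ verts → v ∈ verts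
  sibling_mem : ∀ (v : Vertex q r) (a b : Fin q), v.extend [a] ∈ verts → v.extend [b] ∈ verts

/-- The leaves (childless vertices) of the subforest. They are the roots of the trees of the
planar forest obtained by removing the edges and the internal vertices of the subforest. -/
def FiniteSubforest.leaves (A : FiniteSubforest q r) : Finset (Vertex q r) :=
  A.verts.filter (fun v => ∀ a : Fin q, v.extend [a] ∉ A.verts)

/-- A bijection `e` between the trees of the complements of `A` and of `B` (each tree given by its
root) is realized by a unique isomorphism of planar forests, which sends `v.extend m` to
`(e v).extend m` for each leaf `v` of `A`. This says that `h` is the homeomorphism of the boundary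
induced by this isomorphism. -/
def Represents (A B : FiniteSubforest q r) (e : A.leaves ≃ B.leaves)
    (h : Boundary q r ≃ₜ Boundary q r) : Prop :=
  ∀ (v : A.leaves) (w : ℕ → Fin q), h (v.1.ray w) = (e v).1.ray w

/-- The permutation of `{0, …, n - 1}` associated with `e`, where `n` is the number of trees in the
complements of `A` and of `B` and the trees on both sides are numbered in the order of
their roots. -/
noncomputable def treePerm (A B : FiniteSubforest q r) (e : A.leaves ≃ B.leaves) :
    Equiv.Perm (Fin A.leaves.card) :=
  ((A.leaves.orderIsoOfFin rfl).toEquiv.trans e).trans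
    (B.leaves.orderIsoOfFin (Finset.card_eq_of_equiv e).symm).toEquiv.symm

/-! Auxiliary facts showing that the homeomorphisms with a representative form a group. -/

theorem Vertex.extend_nil (v : Vertex q r) : v.extend [] = v := by
  simp [Vertex.extend]

theorem Vertex.extend_extend (v : Vertex q r) (l m : List (Fin q)) :
    (v.extend l).extend m = v.extend (l ++ m) := by
  simp [Vertex.extend]

theorem prepend_append (l m : List (Fin q)) (w : ℕ → Fin q) :
    prepend (l ++ m) w = prepend l (prepend m w) := by
  induction l with
  | nil => funext n; simp [prepend]
  | cons a l ih =>
    funext n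
    cases n with
    | zero => simp [prepend]
    | succ n => simp [prepend, ih]

theorem Vertex.ray_extend (v : Vertex q r) (m : List (Fin q)) (w : ℕ → Fin q) :
    (v.extend m).ray w = v.ray (prepend m w) := by
  simp [Vertex.ray, Vertex.extend, prepend_append]

theorem prepend_comparable (l l' : List (Fin q)) (w w' : ℕ → Fin q)
    (h : prepend l w = prepend l' w') : (∃ m, l' = l ++ m) ∨ (∃ m, l = l' ++ m) := by
  induction l generalizing l' with
  | nil => exact Or.inl ⟨l', rfl⟩
  | cons a l ih =>
    cases l' with
    | nil => exact Or.inr ⟨a :: l, rfl⟩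
    | cons b l' =>
      have h0 : a = b := congrFun h 0
      have h1 : prepend l w = prepend l' w' := by
        funext n
        exact congrFun h (n + 1)
      subst h0
      rcases ih l' h1 with ⟨m, hm⟩ | ⟨m, hm⟩
      · exact Or.inl ⟨m, by rw [hm]; rfl⟩
      · exact Or.inr ⟨m, by rw [hm]; rfl⟩

namespace FiniteSubforest

theorem mem_leaves (A : FiniteSubforest q r) (v : Vertex q r) :
    v ∈ A.leaves ↔ v ∈ A.verts ∧ ∀ a : Fin q, v.extend [a] ∉ A.verts := by
  simp [leaves]

theorem mem_of_extend_mem (A : FiniteSubforest q r) (v : Vertex q r) (m : List (Fin q))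
    (h : v.extend m ∈ A.verts) : v ∈ A.verts := by
  induction m using List.reverseRecOn with
  | nil => rwa [Vertex.extend_nil] at h
  | append_singleton m a ih =>
    rw [← Vertex.extend_extend] at h
    exact ih (A.parent_mem _ _ h)

theorem eq_nil_of_leaf (A : FiniteSubforest q r) (v : Vertex q r) (m : List (Fin q))
    (hv : v ∈ A.leaves) (h : v.extend m ∈ A.verts) : m = [] := by
  cases m with
  | nil => rfl
  | cons a m =>
    have : (v.extend [a]).extend m ∈ A.verts := by rwa [Vertex.extend_extend]
    exact absurd (A.mem_of_extend_mem _ _ this) (((A.mem_leaves v).1 hv).2 a)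

theorem leaf_unique (A : FiniteSubforest q r) (v v' : Vertex q r) (w w' : ℕ → Fin q)
    (hv : v ∈ A.leaves) (hv' : v' ∈ A.leaves) (h : v.ray w = v'.ray w') : v = v' := by
  have ht : v.tree = v'.tree := congrArg Prod.fst h
  have hp : prepend v.path w = prepend v'.path w' := congrArg Prod.snd h
  rcases prepend_comparable _ _ _ _ hp with ⟨m, hm⟩ | ⟨m, hm⟩
  · have e : v' = v.extend m := Vertex.ext ht.symm hm
    have := A.eq_nil_of_leaf v m hv (e ▸ ((A.mem_leaves v').1 hv').1)
    rw [e, this, Vertex.extend_nil]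
  · have e : v = v'.extend m := Vertex.ext ht hm
    have := A.eq_nil_of_leaf v' m hv' (e ▸ ((A.mem_leaves v).1 hv).1)
    rw [e, this, Vertex.extend_nil]

theorem mem_or_below_leaf (A : FiniteSubforest q r) (v : Vertex q r) :
    v ∈ A.verts ∨ ∃ u ∈ A.leaves, ∃ m, v = u.extend m := by
  obtain ⟨i, l⟩ := v
  induction l using List.reverseRecOn with
  | nil => exact Or.inl (A.root_mem i)
  | append_singleton l a ih =>
    have e : (⟨i, l ++ [a]⟩ : Vertex q r) = (⟨i, l⟩ : Vertex q r).extend [a] := rfl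
    rw [e]
    rcases ih with h | ⟨u, hu, m, hm⟩
    · by_cases hl : (⟨i, l⟩ : Vertex q r) ∈ A.leaves
      · exact Or.inr ⟨_, hl, [a], rfl⟩
      · rw [mem_leaves] at hl
        push Not at hl
        obtain ⟨b, hb⟩ := hl h
        exact Or.inl (A.sibling_mem _ b a hb)
    · exact Or.inr ⟨u, hu, m ++ [a], by rw [hm, Vertex.extend_extend]⟩

theorem leaf_above (A B : FiniteSubforest q r) (hAB : A.verts ⊆ B.verts) (v : Vertex q r)
    (hv : v ∈ B.leaves) : ∃ u ∈ A.leaves, ∃ m, v = u.extend m := by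
  rcases A.mem_or_below_leaf v with h | h
  · refine ⟨v, (A.mem_leaves v).2 ⟨h, fun a ha => ?_⟩, [], v.extend_nil.symm⟩
    exact ((B.mem_leaves v).1 hv).2 a (hAB ha)
  · exact h

/-- The union of two subforests. -/
def union (A B : FiniteSubforest q r) : FiniteSubforest q r where
  verts := A.verts ∪ B.verts
  root_mem i := Finset.mem_union_left _ (A.root_mem i)
  parent_mem v a h := by
    rw [Finset.mem_union] at h ⊢
    exact h.imp (A.parent_mem v a) (B.parent_mem v a)
  sibling_mem v a b h := by
    rw [Finset.mem_union] at h ⊢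
    exact h.imp (A.sibling_mem v a b) (B.sibling_mem v a b)

/-- The subforest consisting of the `r` roots only. -/
def roots (q r : ℕ) : FiniteSubforest q r where
  verts := Finset.univ.image (fun i : Fin r => (⟨i, []⟩ : Vertex q r))
  root_mem i := by simp
  parent_mem v a h := by
    rw [Finset.mem_image] at h
    obtain ⟨i, -, hi⟩ := h
    have := congrArg Vertex.path hi
    simp [Vertex.extend] at this
  sibling_mem v a b h := by
    rw [Finset.mem_image] at h
    obtain ⟨i, -, hi⟩ := h
    have := congrArg Vertex.path hi
    simp [Vertex.extend] at this

open Classical in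
/-- Given a bijection `e` from the leaves of `A` to the leaves of `B`, the subforest obtained by
attaching to each leaf `u` of `A` the part of `C` below `e u`. -/
noncomputable def attach (A B C : FiniteSubforest q r) (e : A.leaves ≃ B.leaves) :
    FiniteSubforest q r where
  verts := A.verts ∪ (A.leaves.attach ×ˢ C.verts).image
    (fun p => if ∃ m, p.2 = (e p.1).1.extend m
      then p.1.1.extend (p.2.path.drop (e p.1).1.path.length) else p.1.1)
  root_mem i := Finset.mem_union_left _ (A.root_mem i)
  parent_mem v a h := by
    rw [Finset.mem_union, Finset.mem_image] at h
    rcases h with h | ⟨⟨u, c⟩, hp, h⟩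
    · exact Finset.mem_union_left _ (A.parent_mem v a h)
    · rw [Finset.mem_product] at hp
      have hc : c ∈ C.verts := hp.2
      split_ifs at h with hm
      · obtain ⟨m, hm⟩ := hm
        dsimp only at hm h
        have hd : c.path.drop (e u).1.path.length = m := by simp [hm, Vertex.extend]
        rw [hd] at h
        rcases List.eq_nil_or_concat' m with rfl | ⟨m', b, rfl⟩
        · rw [Vertex.extend_nil] at h
          exact Finset.mem_union_left _
            (A.parent_mem v a (h ▸ ((A.mem_leaves _).1 u.2).1))
        · rw [← Vertex.extend_extend] at h hm
          have hv : u.1.extend m' = v := by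
            have h1 := congrArg Vertex.tree h
            have h2 := congrArg Vertex.path h
            simp only [Vertex.extend] at h1 h2
            exact Vertex.ext h1 (List.append_inj_left' h2 rfl)
          refine Finset.mem_union_right _ (Finset.mem_image.2
            ⟨(u, (e u).1.extend m'), Finset.mem_product.2
              ⟨Finset.mem_attach _ _, C.parent_mem _ b (hm ▸ hc)⟩, ?_⟩)
          rw [if_pos ⟨m', rfl⟩]
          simpa [Vertex.extend] using hv
      · exact Finset.mem_union_left _
          (A.parent_mem v a (h ▸ ((A.mem_leaves _).1 u.2).1))
  sibling_mem v a b h := by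
    rw [Finset.mem_union, Finset.mem_image] at h
    rcases h with h | ⟨⟨u, c⟩, hp, h⟩
    · exact Finset.mem_union_left _ (A.sibling_mem v a b h)
    · rw [Finset.mem_product] at hp
      have hc : c ∈ C.verts := hp.2
      split_ifs at h with hm
      · obtain ⟨m, hm⟩ := hm
        dsimp only at hm h
        have hd : c.path.drop (e u).1.path.length = m := by simp [hm, Vertex.extend]
        rw [hd] at h
        rcases List.eq_nil_or_concat' m with rfl | ⟨m', d, rfl⟩
        · rw [Vertex.extend_nil] at h
          exact Finset.mem_union_left _
            (A.sibling_mem v a b (h ▸ ((A.mem_leaves _).1 u.2).1))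
        · rw [← Vertex.extend_extend] at h hm
          have hv : u.1.extend m' = v := by
            have h1 := congrArg Vertex.tree h
            have h2 := congrArg Vertex.path h
            simp only [Vertex.extend] at h1 h2
            exact Vertex.ext h1 (List.append_inj_left' h2 rfl)
          refine Finset.mem_union_right _ (Finset.mem_image.2
            ⟨(u, ((e u).1.extend m').extend [b]), Finset.mem_product.2
              ⟨Finset.mem_attach _ _, C.sibling_mem _ d b (hm ▸ hc)⟩, ?_⟩)
          rw [if_pos ⟨m' ++ [b], by rw [Vertex.extend_extend]⟩, ← hv]
          simp [Vertex.extend]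
      · exact Finset.mem_union_left _
          (A.sibling_mem v a b (h ▸ ((A.mem_leaves _).1 u.2).1))

theorem mem_attach (A B C : FiniteSubforest q r) (e : A.leaves ≃ B.leaves) (v : Vertex q r) :
    v ∈ (attach A B C e).verts ↔ v ∈ A.verts ∨
      ∃ (u : A.leaves) (m : List (Fin q)), (e u).1.extend m ∈ C.verts ∧ v = u.1.extend m := by
  constructor
  · intro h
    rcases Finset.mem_union.1 h with h | h
    · exact Or.inl h
    · obtain ⟨⟨u, c⟩, hp, h⟩ := Finset.mem_image.1 h
      have hc : c ∈ C.verts := (Finset.mem_product.1 hp).2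
      split_ifs at h with hm
      · obtain ⟨m, hm⟩ := hm
        dsimp only at hm h
        refine Or.inr ⟨u, m, hm ▸ hc, ?_⟩
        rw [← h, hm]
        simp [Vertex.extend]
      · exact Or.inl (h ▸ ((A.mem_leaves _).1 u.2).1)
  · rintro (h | ⟨u, m, hm, rfl⟩)
    · exact Finset.mem_union_left _ h
    · refine Finset.mem_union_right _ (Finset.mem_image.2
        ⟨(u, (e u).1.extend m), Finset.mem_product.2 ⟨Finset.mem_attach _ _, hm⟩, ?_⟩)
      rw [if_pos ⟨m, rfl⟩]
      simp [Vertex.extend]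

theorem mem_leaves_attach (A B C : FiniteSubforest q r) (e : A.leaves ≃ B.leaves)
    (hBC : B.verts ⊆ C.verts) (v : Vertex q r) :
    v ∈ (attach A B C e).leaves ↔
      ∃ (u : A.leaves) (m : List (Fin q)), (e u).1.extend m ∈ C.leaves ∧ v = u.1.extend m := by
  rw [mem_leaves]
  constructor
  · rintro ⟨h, hc⟩
    have key : ∃ (u : A.leaves) (m : List (Fin q)),
        (e u).1.extend m ∈ C.verts ∧ v = u.1.extend m := by
      rcases (mem_attach A B C e v).1 h with h | h
      · have hl : v ∈ A.leaves := (A.mem_leaves v).2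
          ⟨h, fun a ha => hc a ((mem_attach A B C e _).2 (Or.inl ha))⟩
        refine ⟨⟨v, hl⟩, [], ?_, v.extend_nil.symm⟩
        rw [Vertex.extend_nil]
        exact hBC ((B.mem_leaves _).1 (e ⟨v, hl⟩).2).1
      · exact h
    obtain ⟨u, m, hm, rfl⟩ := key
    refine ⟨u, m, (C.mem_leaves _).2 ⟨hm, fun a ha => hc a ?_⟩, rfl⟩
    rw [Vertex.extend_extend] at ha ⊢
    exact (mem_attach A B C e _).2 (Or.inr ⟨u, _, ha, rfl⟩)
  · rintro ⟨u, m, hm, rfl⟩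
    rw [mem_leaves] at hm
    refine ⟨(mem_attach A B C e _).2 (Or.inr ⟨u, m, hm.1, rfl⟩), fun a ha => ?_⟩
    rw [Vertex.extend_extend] at ha
    rcases (mem_attach A B C e _).1 ha with h | ⟨u', m', hm', h⟩
    · have := A.eq_nil_of_leaf _ _ u.2 h
      simp at this
    · have hu : u = u' := Subtype.ext (A.leaf_unique u.1 u'.1
        (prepend (m ++ [a]) fun _ => a) (prepend m' fun _ => a) u.2 u'.2
        (by rw [← Vertex.ray_extend, ← Vertex.ray_extend, h]))
      subst hu
      have h2 := congrArg Vertex.path h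
      simp only [Vertex.extend] at h2
      have h3 := List.append_cancel_left h2
      subst h3
      rw [← Vertex.extend_extend] at hm'
      exact hm.2 a hm'

end FiniteSubforest

theorem exists_equiv_of_relation [NeZero q] (A B : FiniteSubforest q r)
    (h : Boundary q r ≃ₜ Boundary q r)
    (h1 : ∀ a ∈ A.leaves, ∃ b ∈ B.leaves, ∀ w, h (a.ray w) = b.ray w)
    (h2 : ∀ b ∈ B.leaves, ∃ a ∈ A.leaves, ∀ w, h (a.ray w) = b.ray w) :
    ∃ e : A.leaves ≃ B.leaves, Represents A B e h := by
  choose f hf hfr using h1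
  have hbij : Function.Bijective (fun a : A.leaves => (⟨f a.1 a.2, hf a.1 a.2⟩ : B.leaves)) := by
    constructor
    · intro a a' haa
      have haa' : f a.1 a.2 = f a'.1 a'.2 := congrArg Subtype.val haa
      have := hfr a.1 a.2 (fun _ => 0)
      rw [haa', ← hfr a'.1 a'.2] at this
      exact Subtype.ext (A.leaf_unique _ _ _ _ a.2 a'.2 (h.injective this))
    · intro b
      obtain ⟨a, ha, hr⟩ := h2 b.1 b.2
      refine ⟨⟨a, ha⟩, Subtype.ext (B.leaf_unique _ _ (fun _ => 0) (fun _ => 0)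
        (hf a ha) b.2 ?_)⟩
      rw [← hfr a ha, ← hr]
  exact ⟨Equiv.ofBijective _ hbij, fun v w => hfr v.1 v.2 w⟩

theorem Represents.symm {A B : FiniteSubforest q r} {e : A.leaves ≃ B.leaves}
    {h : Boundary q r ≃ₜ Boundary q r} (H : Represents A B e h) :
    Represents B A e.symm h.symm := by
  intro v w
  rw [Homeomorph.symm_apply_eq, H, Equiv.apply_symm_apply]

theorem Represents.refine [NeZero q] {A B : FiniteSubforest q r} {e : A.leaves ≃ B.leaves}
    {h : Boundary q r ≃ₜ Boundary q r} (H : Represents A B e h) (C : FiniteSubforest q r)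
    (hBC : B.verts ⊆ C.verts) :
    ∃ (D : FiniteSubforest q r) (d : D.leaves ≃ C.leaves), Represents D C d h := by
  refine ⟨A.attach B C e, exists_equiv_of_relation _ _ h (fun a ha => ?_) (fun b hb => ?_)⟩
  · obtain ⟨u, m, hm, rfl⟩ := (FiniteSubforest.mem_leaves_attach A B C e hBC a).1 ha
    refine ⟨_, hm, fun w => ?_⟩
    rw [Vertex.ray_extend, Vertex.ray_extend, H]
  · obtain ⟨u, hu, m, rfl⟩ := B.leaf_above C hBC b hb
    refine ⟨(e.symm ⟨u, hu⟩).1.extend m,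
      (FiniteSubforest.mem_leaves_attach A B C e hBC _).2
        ⟨e.symm ⟨u, hu⟩, m, by simpa using hb, rfl⟩, fun w => ?_⟩
    rw [Vertex.ray_extend, Vertex.ray_extend, H, Equiv.apply_symm_apply]

/-- The Higman–Thompson group `G_{q,r}`: the group of all homeomorphisms of the boundary of the
forest that are induced by an isomorphism of planar forests between the complements of two
finite subforests. -/
def higmanThompsonGroup (q r : ℕ) : Subgroup (Boundary q r ≃ₜ Boundary q r) where
  carrier := {h | ∃ (A B : FiniteSubforest q r) (e : A.leaves ≃ B.leaves), Represents A B e h}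
  one_mem' :=
    ⟨FiniteSubforest.roots q r, FiniteSubforest.roots q r, Equiv.refl _, fun _ _ => rfl⟩
  mul_mem' := by
    rintro k h ⟨C, D, f, K⟩ ⟨A, B, e, H⟩
    rcases Nat.eq_zero_or_pos q with rfl | hq
    · exact ⟨A, A, Equiv.refl _, fun _ w => (w 0).elim0⟩
    · have : NeZero q := ⟨hq.ne'⟩
      obtain ⟨A', e', H'⟩ := H.refine (B.union C) Finset.subset_union_left
      obtain ⟨D', f', K'⟩ := K.symm.refine (B.union C) Finset.subset_union_right
      refine ⟨A', D', e'.trans f'.symm, fun v w => ?_⟩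
      have h1 : (k * h) (v.1.ray w) = k (h (v.1.ray w)) := rfl
      rw [h1, H']
      exact K'.symm (e' v) w
  inv_mem' := by
    rintro h ⟨A, B, e, H⟩
    exact ⟨B, A, e.symm, H.symm⟩

/-- The property that characterizes the homomorphism `θ : G_{q,r} → ℤ/2ℤ` (the group `ℤ/2ℤ` being
written multiplicatively, as `ℤˣ = {1, -1}`): it is trivial if `q` is even, and, if `q` is odd, its
value at an element is the sign of the permutation associated with any representative. -/
def IsTheta (θ : higmanThompsonGroup q r →* ℤˣ) : Prop :=
  (Even q → θ = 1) ∧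
  (Odd q → ∀ (g : higmanThompsonGroup q r) (A B : FiniteSubforest q r) (e : A.leaves ≃ B.leaves),
    Represents A B e g.1 → θ g = Equiv.Perm.sign (treePerm A B e))

end HigmanThompson

namespace HigmanThompson

variable {q r : ℕ}

/-! ### Rays and cones -/

/-! The group behaves like symmetric groups glued along subdivision. Its transpositions are the
swaps `sw u v` of two disjoint cones, and they generate (`closure_swaps`): after permuting the
leaves of the codomain, a caret of the domain is carried in order to a caret of the codomain and can
be collapsed, until only the roots remain.

A swap is the product of the `q` swaps of corresponding children (`sw_eq_prod`), so parity survives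
subdivision only for odd `q`. In that case each inversion of a representative is repeated an odd
number of times in a refinement, hence the sign does not depend on the representative
(`Represents.sign_treePerm_eq`); it is multiplicative because two representatives can be refined
until they compose. Swaps have sign `-1`, so the kernel is the group `evenSubgroup` generated by
products of two swaps. For even `q` this group is everything (`IsTheta.ker_eq`).

The rest follows from one statement (`evenSubgroup_le_of_normalized`): a nontrivial subgroup `N`
normalized by `evenSubgroup` contains it. A nontrivial element of `N` carries some cone off itself,
and a double commutator then puts a three-cycle of cones in `N`. Conjugation by even elements yields
all three-cycles of small cones, these yield all products of two swaps of small cones, and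
subdivision yields the others. Applied to the commutator subgroup, this identifies it with the
kernel; applied to normal subgroups of `evenSubgroup`, it gives simplicity. -/

theorem prepend_apply_lt (l : List (Fin q)) (w : ℕ → Fin q) (i : ℕ) (h : i < l.length) :
    prepend l w i = l[i] := by
  induction l generalizing i with
  | nil => simp at h
  | cons a l ih =>
    cases i with
    | zero => rfl
    | succ i => exact ih i (by simpa using h)

theorem prepend_apply_add (l : List (Fin q)) (w : ℕ → Fin q) (i : ℕ) :
    prepend l w (l.length + i) = w i := by
  induction l with
  | nil => simp [prepend]
  | cons a l ih =>
    rw [List.length_cons, Nat.add_right_comm]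
    exact ih

theorem eq_prepend (l : List (Fin q)) (f : ℕ → Fin q)
    (h : ∀ (i : ℕ) (hi : i < l.length), f i = l[i]) :
    f = prepend l (fun i => f (l.length + i)) := by
  funext i
  rcases lt_or_ge i l.length with hi | hi
  · rw [prepend_apply_lt _ _ _ hi, h i hi]
  · obtain ⟨j, rfl⟩ := Nat.exists_eq_add_of_le hi
    rw [prepend_apply_add]

theorem prepend_head (w : ℕ → Fin q) : prepend [w 0] (fun i => w (i + 1)) = w := by
  funext i
  cases i <;> rfl

theorem Vertex.ray_injective (v : Vertex q r) : Function.Injective v.ray := by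
  intro w w' h
  funext i
  have := congrFun (congrArg Prod.snd h) (v.path.length + i)
  simpa [Vertex.ray, prepend_apply_add] using this

/-- The part of the end `x` after the first `n` steps. -/
def tail (n : ℕ) (x : Boundary q r) : ℕ → Fin q := fun i => x.2 (n + i)

theorem tail_ray (v : Vertex q r) (w : ℕ → Fin q) : tail v.path.length (v.ray w) = w := by
  funext i
  simp [tail, Vertex.ray, prepend_apply_add]

/-- The set of ends below `v`. -/
def cone (v : Vertex q r) : Set (Boundary q r) := Set.range v.ray

theorem mem_cone_iff (v : Vertex q r) (x : Boundary q r) :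
    x ∈ cone v ↔ x.1 = v.tree ∧ ∀ i : Fin v.path.length, x.2 i = v.path.get i := by
  constructor
  · rintro ⟨w, rfl⟩
    exact ⟨rfl, fun i => prepend_apply_lt _ _ _ i.2⟩
  · rintro ⟨h1, h2⟩
    exact ⟨tail v.path.length x, Prod.ext h1.symm
      (eq_prepend v.path x.2 fun i hi => h2 ⟨i, hi⟩).symm⟩

theorem isClopen_cone (v : Vertex q r) : IsClopen (cone v) := by
  have : cone v = Prod.fst ⁻¹' {v.tree} ∩
      ⋂ i : Fin v.path.length, (fun x : Boundary q r => x.2 i) ⁻¹' {v.path.get i} := by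
    ext x
    simp [mem_cone_iff]
  rw [this]
  refine ((isClopen_discrete _).preimage continuous_fst).inter
    (isClopen_iInter_of_finite fun i => (isClopen_discrete _).preimage (by fun_prop))

theorem continuous_prepend (l : List (Fin q)) : Continuous (prepend l) := by
  refine continuous_pi fun i => ?_
  rcases lt_or_ge i l.length with hi | hi
  · simp only [prepend_apply_lt l _ i hi]
    exact continuous_const
  · obtain ⟨j, rfl⟩ := Nat.exists_eq_add_of_le hi
    simp only [prepend_apply_add]
    exact continuous_apply j

theorem continuous_ray (v : Vertex q r) : Continuous v.ray :=
  continuous_const.prodMk (continuous_prepend _)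

theorem continuous_tail (n : ℕ) : Continuous (tail (q := q) (r := r) n) :=
  continuous_pi fun i => (continuous_apply (n + i)).comp continuous_snd

theorem exists_ray_eq (x : Boundary q r) (d : ℕ) :
    ∃ (v : Vertex q r) (w : ℕ → Fin q), v.path.length = d ∧ v.ray w = x := by
  have hl : (List.ofFn fun i : Fin d => x.2 i).length = d := by simp
  refine ⟨⟨x.1, List.ofFn fun i : Fin d => x.2 i⟩, tail d x, hl, ?_⟩
  have := eq_prepend (List.ofFn fun i : Fin d => x.2 i) x.2 (by simp)
  refine Prod.ext rfl ?_
  rw [hl] at this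
  exact this.symm

/-- Two vertices are disjoint if no end lies below both of them. -/
def Disj (u v : Vertex q r) : Prop := ∀ w w', u.ray w ≠ v.ray w'

theorem Disj.symm {u v : Vertex q r} (h : Disj u v) : Disj v u := fun w w' e => h w' w e.symm

theorem Disj.extend_left {u v : Vertex q r} (h : Disj u v) (m : List (Fin q)) :
    Disj (u.extend m) v := by
  intro w w'
  rw [Vertex.ray_extend]
  exact h _ _

theorem Disj.extend {u v : Vertex q r} (h : Disj u v) (m m' : List (Fin q)) :
    Disj (u.extend m) (v.extend m') :=
  ((h.extend_left m).symm.extend_left m').symm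

theorem Disj.notMem_cone {u v : Vertex q r} (h : Disj u v) (w : ℕ → Fin q) :
    u.ray w ∉ cone v := fun ⟨w', hw⟩ => h w w' hw.symm

theorem Disj.ne [NeZero q] {u v : Vertex q r} (h : Disj u v) : u ≠ v := by
  rintro rfl
  exact h (fun _ => 0) (fun _ => 0) rfl

theorem Vertex.comparable {u v : Vertex q r} (h : ¬ Disj u v) :
    (∃ m, v = u.extend m) ∨ ∃ m, u = v.extend m := by
  simp only [Disj, not_forall, not_not] at h
  obtain ⟨w, w', h⟩ := h
  have ht : u.tree = v.tree := congrArg Prod.fst h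
  exact (prepend_comparable _ _ _ _ (congrArg Prod.snd h)).imp
    (fun ⟨m, hm⟩ => ⟨m, Vertex.ext ht.symm hm⟩) (fun ⟨m, hm⟩ => ⟨m, Vertex.ext ht hm⟩)

theorem Vertex.extend_eq_self {u : Vertex q r} {m : List (Fin q)} (h : u.extend m = u) :
    m = [] := by
  have := congrArg Vertex.path h
  simpa [Vertex.extend] using this

theorem Vertex.length_extend (u : Vertex q r) (m : List (Fin q)) :
    (u.extend m).path.length = u.path.length + m.length := by
  simp [Vertex.extend]

theorem disj_of_length_eq {u v : Vertex q r} (h : u.path.length = v.path.length) (hne : u ≠ v) :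
    Disj u v := by
  by_contra hd
  rcases Vertex.comparable hd with ⟨m, rfl⟩ | ⟨m, rfl⟩
  all_goals
    rw [Vertex.length_extend] at h
    have : m = [] := List.length_eq_zero_iff.1 (by omega)
    subst this
    simp [Vertex.extend_nil] at hne

theorem extend_singleton_injective (u : Vertex q r) :
    Function.Injective fun a : Fin q => u.extend [a] := by
  intro a b h
  have := congrArg Vertex.path h
  simpa [Vertex.extend] using this

theorem disj_children (u : Vertex q r) {a b : Fin q} (h : a ≠ b) :
    Disj (u.extend [a]) (u.extend [b]) :=
  disj_of_length_eq (by simp [Vertex.extend]) fun e => h (extend_singleton_injective u e)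

theorem Vertex.extend_singleton_inj {u v : Vertex q r} {a b : Fin q}
    (h : u.extend [a] = v.extend [b]) : u = v := by
  have h1 := congrArg Vertex.tree h
  have h2 := congrArg Vertex.path h
  simp only [Vertex.extend] at h1 h2
  exact Vertex.ext h1 (List.append_inj_left' h2 rfl)

theorem Vertex.eq_extend_of_extend_singleton {u v : Vertex q r} {a : Fin q} {m : List (Fin q)}
    (h : v.extend [a] = u.extend m) (hm : m ≠ []) : ∃ m', m = m' ++ [a] ∧ v = u.extend m' := by
  rcases List.eq_nil_or_concat' m with rfl | ⟨m', b, rfl⟩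
  · exact absurd rfl hm
  · rw [← Vertex.extend_extend] at h
    have hb : a = b := by
      have h2 := congrArg Vertex.path h
      simp only [Vertex.extend] at h2
      simpa using List.append_inj_right' h2 rfl
    exact ⟨m', by rw [hb], Vertex.extend_singleton_inj h⟩

/-! ### Subforests with prescribed leaves -/

namespace FiniteSubforest

theorem leaves_disj (A : FiniteSubforest q r) {u v : Vertex q r} (hu : u ∈ A.leaves)
    (hv : v ∈ A.leaves) (h : u ≠ v) : Disj u v :=
  fun w w' e => h (A.leaf_unique _ _ w w' hu hv e)

theorem exists_length_lt (A : FiniteSubforest q r) : ∃ d, ∀ v ∈ A.verts, v.path.length < d :=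
  ⟨A.verts.sup (fun v => v.path.length) + 1, fun _ hv => Nat.lt_succ_of_le
    (Finset.le_sup (f := fun v : Vertex q r => v.path.length) hv)⟩

/-- A ray followed deeper than the whole subforest has left it, hence has met a leaf. Together with
`leaf_unique`: the cones of the leaves partition the boundary. -/
theorem exists_leaf_ray (A : FiniteSubforest q r) (x : Boundary q r) :
    ∃ v ∈ A.leaves, ∃ w, v.ray w = x := by
  obtain ⟨d, hd⟩ := A.exists_length_lt
  obtain ⟨v, w, hv, rfl⟩ := exists_ray_eq x d
  rcases A.mem_or_below_leaf v with h | ⟨u, hu, m, rfl⟩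
  · exact absurd (hd v h) (by omega)
  · exact ⟨u, hu, prepend m w, by rw [Vertex.ray_extend]⟩

theorem finite_length_le (q r d : ℕ) : {v : Vertex q r | v.path.length ≤ d}.Finite := by
  have : {v : Vertex q r | v.path.length ≤ d} ⊆
      (fun p : Fin r × List (Fin q) => (⟨p.1, p.2⟩ : Vertex q r)) ''
        (Set.univ ×ˢ {l | l.length ≤ d}) := by
    rintro ⟨i, l⟩ h
    exact ⟨(i, l), ⟨trivial, h⟩, rfl⟩
  exact ((Set.finite_univ.prod (List.finite_length_le _ _)).image _).subset this

open Classical in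
/-- The subforest of the vertices of depth at most `d` that lie strictly below no vertex in `S`. -/
noncomputable def truncate (S : Finset (Vertex q r)) (d : ℕ) : FiniteSubforest q r where
  verts := (finite_length_le q r d).toFinset.filter
    fun v => ∀ u ∈ S, ∀ m, m ≠ [] → v ≠ u.extend m
  root_mem i := by
    simp only [Finset.mem_filter, Set.Finite.mem_toFinset, Set.mem_ofPred_eq]
    refine ⟨Nat.zero_le _, fun u _ m hm h => hm ?_⟩
    have := congrArg Vertex.path h
    simp only [Vertex.extend] at this
    exact (List.append_eq_nil_iff.1 this.symm).2
  parent_mem v a h := by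
    simp only [Finset.mem_filter, Set.Finite.mem_toFinset, Set.mem_ofPred_eq,
      Vertex.length_extend] at h ⊢
    refine ⟨by omega, fun u hu m hm e => h.2 u hu (m ++ [a]) (by simp) ?_⟩
    rw [e, Vertex.extend_extend]
  sibling_mem v a b h := by
    simp only [Finset.mem_filter, Set.Finite.mem_toFinset, Set.mem_ofPred_eq,
      Vertex.length_extend] at h ⊢
    refine ⟨h.1, fun u hu m hm e => ?_⟩
    obtain ⟨m', -, rfl⟩ := Vertex.eq_extend_of_extend_singleton e hm
    exact h.2 u hu (m' ++ [a]) (by simp) (by rw [Vertex.extend_extend])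

theorem mem_truncate {S : Finset (Vertex q r)} {d : ℕ} {v : Vertex q r} :
    v ∈ (truncate S d).verts ↔
      v.path.length ≤ d ∧ ∀ u ∈ S, ∀ m, m ≠ [] → v ≠ u.extend m := by
  simp [truncate]

/-- Any finite set of pairwise disjoint vertices thus extends to the leaf set of a subforest:
branches that meet no member of `S` run down to depth `d`. For empty `S` this is the full ball. -/
theorem mem_leaves_truncate [NeZero q] {S : Finset (Vertex q r)} {d : ℕ}
    (hd : ∀ u ∈ S, u.path.length ≤ d) (hS : ∀ u ∈ S, ∀ v ∈ S, u ≠ v → Disj u v) {v : Vertex q r} :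
    v ∈ (truncate S d).leaves ↔ v ∈ S ∨ (v.path.length = d ∧ ∀ u ∈ S, Disj v u) := by
  rw [mem_leaves]
  constructor
  · rintro ⟨h1, h2⟩
    by_cases hv : v ∈ S
    · exact Or.inl hv
    · rw [mem_truncate] at h1
      have hvd : v.path.length = d := by
        by_contra hne
        refine h2 0 (mem_truncate.2 ⟨?_, fun u hu m hm e => ?_⟩)
        · rw [Vertex.length_extend]
          have := h1.1
          simp only [List.length_singleton]
          omega
        · obtain ⟨m', -, rfl⟩ := Vertex.eq_extend_of_extend_singleton e hm
          by_cases hm' : m' = []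
          · subst hm'
            rw [Vertex.extend_nil] at hv
            exact hv hu
          · exact h1.2 u hu m' hm' rfl
      refine Or.inr ⟨hvd, fun u hu => ?_⟩
      by_contra hdis
      rcases Vertex.comparable hdis with ⟨m, rfl⟩ | ⟨m, rfl⟩
      · have := hd _ hu
        rw [Vertex.length_extend] at this
        have : m = [] := List.length_eq_zero_iff.1 (by omega)
        subst this
        rw [Vertex.extend_nil] at hu
        exact hv hu
      · by_cases hm : m = []
        · subst hm
          rw [Vertex.extend_nil] at hv
          exact hv hu
        · exact h1.2 u hu m hm rfl
  · rintro (h | ⟨h, h'⟩)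
    · refine ⟨mem_truncate.2 ⟨hd v h, fun u hu m hm e => ?_⟩, fun a ha => ?_⟩
      · have hne : v ≠ u := fun e' => hm (Vertex.extend_eq_self (e'.symm.trans e).symm)
        refine hS v h u hu hne (fun _ => 0) (prepend m fun _ => 0) ?_
        rw [e, Vertex.ray_extend]
      · exact (mem_truncate.1 ha).2 v h [a] (by simp) rfl
    · refine ⟨mem_truncate.2 ⟨h.le, fun u hu m hm e => ?_⟩, fun a ha => ?_⟩
      · refine h' u hu (fun _ => 0) (prepend m fun _ => 0) ?_
        rw [e, Vertex.ray_extend]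
      · have := (mem_truncate.1 ha).1
        rw [Vertex.length_extend] at this
        simp only [List.length_singleton] at this
        omega

end FiniteSubforest

/-- The bijection `h` sends the cone of `u` to the cone of `v` by the canonical map. -/
def Maps (h : Boundary q r ≃ₜ Boundary q r) (u v : Vertex q r) : Prop :=
  ∀ w, h (u.ray w) = v.ray w

theorem Maps.extend {h : Boundary q r ≃ₜ Boundary q r} {u v : Vertex q r} (H : Maps h u v)
    (m : List (Fin q)) : Maps h (u.extend m) (v.extend m) := by
  intro w
  rw [Vertex.ray_extend, Vertex.ray_extend, H]

theorem Maps.disj {h : Boundary q r ≃ₜ Boundary q r} {u v u' v' : Vertex q r} (H : Maps h u u')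
    (H' : Maps h v v') (d : Disj u v) : Disj u' v' := by
  intro w w' e
  rw [← H, ← H'] at e
  exact d _ _ (h.injective e)

/-- Two letters are needed: a proper descendant leaves out the rays that start with another letter.
For `q = 1` all vertices of a tree have the same ray. -/
theorem ray_vertex_injective (hq : 2 ≤ q) {u v : Vertex q r} (h : ∀ w, u.ray w = v.ray w) :
    u = v := by
  have : NeZero q := ⟨by omega⟩
  have key : ∀ (u : Vertex q r) (m : List (Fin q)), (∀ w, (u.extend m).ray w = u.ray w) →
      m = [] := by
    intro u m h
    cases m with
    | nil => rfl
    | cons a m =>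
      have : Nontrivial (Fin q) := Fin.nontrivial_iff_two_le.2 hq
      obtain ⟨b, hb⟩ := exists_ne a
      have := h (fun _ => b)
      rw [Vertex.ray_extend] at this
      exact absurd (congrFun (u.ray_injective this) 0) hb.symm
  have hd : ¬ Disj u v := fun d => d (fun _ => 0) (fun _ => 0) (h _)
  rcases Vertex.comparable hd with ⟨m, rfl⟩ | ⟨m, rfl⟩
  · rw [key u m fun w => (h w).symm, Vertex.extend_nil]
  · rw [key v m h, Vertex.extend_nil]

/-- The images of the leaves are disjoint and their cones cover the boundary, so truncation at them
creates no further leaf. A representative can therefore be given by its domain alone. -/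
theorem exists_represents [NeZero q] (A : FiniteSubforest q r) (h : Boundary q r ≃ₜ Boundary q r)
    (hA : ∀ v ∈ A.leaves, ∃ u, Maps h v u) :
    ∃ (B : FiniteSubforest q r) (e : A.leaves ≃ B.leaves), Represents A B e h := by
  classical
  choose f hf using hA
  set S : Finset (Vertex q r) := A.leaves.attach.image fun v => f v.1 v.2 with hSdef
  have hmem : ∀ u, u ∈ S ↔ ∃ (v : Vertex q r) (hv : v ∈ A.leaves), f v hv = u := by
    intro u
    simp [hSdef]
  have hS : ∀ u ∈ S, ∀ v ∈ S, u ≠ v → Disj u v := by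
    intro u hu v hv hne
    obtain ⟨a, ha, rfl⟩ := (hmem u).1 hu
    obtain ⟨b, hb, rfl⟩ := (hmem v).1 hv
    refine (hf a ha).disj (hf b hb) (A.leaves_disj ha hb ?_)
    rintro rfl
    exact hne rfl
  set d := S.sup fun v => v.path.length with hd
  have hdS : ∀ u ∈ S, u.path.length ≤ d := fun u hu =>
    Finset.le_sup (f := fun v : Vertex q r => v.path.length) hu
  have hcover : ∀ x : Boundary q r, ∃ u ∈ S, x ∈ cone u := by
    intro x
    obtain ⟨v, hv, w, hw⟩ := A.exists_leaf_ray (h.symm x)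
    refine ⟨f v hv, (hmem _).2 ⟨v, hv, rfl⟩, w, ?_⟩
    rw [← hf v hv, hw, Homeomorph.apply_symm_apply]
  have hleaves : ∀ v, v ∈ (FiniteSubforest.truncate S d).leaves ↔ v ∈ S := by
    intro v
    rw [FiniteSubforest.mem_leaves_truncate hdS hS]
    refine ⟨?_, Or.inl⟩
    rintro (h | ⟨-, h⟩)
    · exact h
    · obtain ⟨u, hu, w, hw⟩ := hcover (v.ray fun _ => 0)
      exact absurd hw.symm (h u hu _ _)
  refine ⟨FiniteSubforest.truncate S d, exists_equiv_of_relation _ _ h (fun a ha => ?_)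
    (fun b hb => ?_)⟩
  · exact ⟨f a ha, (hleaves _).2 ((hmem _).2 ⟨a, ha, rfl⟩), hf a ha⟩
  · obtain ⟨a, ha, rfl⟩ := (hmem b).1 ((hleaves b).1 hb)
    exact ⟨a, ha, hf a ha⟩

theorem Represents.maps {A B : FiniteSubforest q r} {e : A.leaves ≃ B.leaves}
    {h : Boundary q r ≃ₜ Boundary q r} (H : Represents A B e h) (v : A.leaves) :
    Maps h v.1 (e v).1 := H v

theorem FiniteSubforest.homeomorph_ext (A : FiniteSubforest q r)
    {g h : Boundary q r ≃ₜ Boundary q r}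
    (H : ∀ v ∈ A.leaves, ∀ w, g (v.ray w) = h (v.ray w)) : g = h := by
  ext1 x
  obtain ⟨v, hv, w, rfl⟩ := A.exists_leaf_ray x
  exact H v hv w

theorem group_ext {g h : higmanThompsonGroup q r} (H : ∀ x, g.1 x = h.1 x) : g = h :=
  Subtype.ext (Homeomorph.ext H)

theorem Maps.mul {g h : higmanThompsonGroup q r} {x y z : Vertex q r} (H : Maps g.1 y z)
    (H' : Maps h.1 x y) : Maps (g * h).1 x z := by
  intro w
  change g.1 (h.1 (x.ray w)) = _
  rw [H', H]

theorem Vertex.ray_eq_child (u : Vertex q r) (w : ℕ → Fin q) :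
    u.ray w = (u.extend [w 0]).ray fun i => w (i + 1) := by
  rw [Vertex.ray_extend, prepend_head]

/-! ### Swapping two cones -/

open Classical in
/-- The map that swaps the cones of `u` and of `v` and fixes all other ends. -/
noncomputable def swapFun (u v : Vertex q r) (x : Boundary q r) : Boundary q r :=
  if x ∈ cone u then v.ray (tail u.path.length x)
  else if x ∈ cone v then u.ray (tail v.path.length x) else x

theorem swapFun_left (u v : Vertex q r) (w : ℕ → Fin q) : swapFun u v (u.ray w) = v.ray w := by
  rw [swapFun, if_pos ⟨w, rfl⟩, tail_ray]

theorem swapFun_right {u v : Vertex q r} (h : Disj u v) (w : ℕ → Fin q) :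
    swapFun u v (v.ray w) = u.ray w := by
  rw [swapFun, if_neg (h.symm.notMem_cone w), if_pos ⟨w, rfl⟩, tail_ray]

theorem swapFun_of_notMem {u v : Vertex q r} {x : Boundary q r} (hu : x ∉ cone u)
    (hv : x ∉ cone v) : swapFun u v x = x := by
  rw [swapFun, if_neg hu, if_neg hv]

theorem swapFun_swapFun {u v : Vertex q r} (h : Disj u v) (x : Boundary q r) :
    swapFun u v (swapFun u v x) = x := by
  by_cases hu : x ∈ cone u
  · obtain ⟨w, rfl⟩ := hu
    rw [swapFun_left, swapFun_right h]
  · by_cases hv : x ∈ cone v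
    · obtain ⟨w, rfl⟩ := hv
      rw [swapFun_right h, swapFun_left]
    · rw [swapFun_of_notMem hu hv, swapFun_of_notMem hu hv]

/-- Cones are clopen, so the cases of the definition have empty frontiers and nothing has to match.
-/
theorem continuous_swapFun (u v : Vertex q r) : Continuous (swapFun u v) := by
  classical
  unfold swapFun
  refine continuous_if (fun x hx => ?_) ?_ ?_
  · have : x ∈ frontier (cone u) := hx
    simp [(isClopen_cone u).frontier_eq] at this
  · exact ((continuous_ray v).comp (continuous_tail _)).continuousOn
  · refine (continuous_if (fun x hx => ?_) ?_ continuousOn_id).continuousOn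
    · have : x ∈ frontier (cone v) := hx
      simp [(isClopen_cone v).frontier_eq] at this
    · exact ((continuous_ray u).comp (continuous_tail _)).continuousOn

/-- The homeomorphism that swaps the cones of two disjoint vertices. -/
noncomputable def swapHomeo (u v : Vertex q r) (h : Disj u v) : Boundary q r ≃ₜ Boundary q r where
  toFun := swapFun u v
  invFun := swapFun u v
  left_inv := swapFun_swapFun h
  right_inv := swapFun_swapFun h
  continuous_toFun := continuous_swapFun u v
  continuous_invFun := continuous_swapFun u v

theorem exists_leaves_pair [NeZero q] {u v : Vertex q r} (h : Disj u v) :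
    ∃ A : FiniteSubforest q r, u ∈ A.leaves ∧ v ∈ A.leaves := by
  classical
  have hS : ∀ x ∈ ({u, v} : Finset (Vertex q r)), ∀ y ∈ ({u, v} : Finset (Vertex q r)),
      x ≠ y → Disj x y := by
    intro x hx y hy hne
    simp only [Finset.mem_insert, Finset.mem_singleton] at hx hy
    rcases hx with rfl | rfl <;> rcases hy with rfl | rfl
    exacts [absurd rfl hne, h, h.symm, absurd rfl hne]
  have hd : ∀ x ∈ ({u, v} : Finset (Vertex q r)),
      x.path.length ≤ max u.path.length v.path.length := by
    simp
  exact ⟨FiniteSubforest.truncate {u, v} (max u.path.length v.path.length),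
    (FiniteSubforest.mem_leaves_truncate hd hS).2 (Or.inl (by simp)),
    (FiniteSubforest.mem_leaves_truncate hd hS).2 (Or.inl (by simp))⟩

theorem represents_swapHomeo (A : FiniteSubforest q r) (u v : A.leaves) (h : Disj u.1 v.1) :
    Represents A A (Equiv.swap u v) (swapHomeo u.1 v.1 h) := by
  intro x w
  change swapFun u.1 v.1 (x.1.ray w) = _
  rcases eq_or_ne x u with rfl | hu
  · rw [Equiv.swap_apply_left, swapFun_left]
  · rcases eq_or_ne x v with rfl | hv
    · rw [Equiv.swap_apply_right, swapFun_right h]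
    · rw [Equiv.swap_apply_of_ne_of_ne hu hv]
      exact swapFun_of_notMem
        ((A.leaves_disj x.2 u.2 fun e => hu (Subtype.ext e)).notMem_cone w)
        ((A.leaves_disj x.2 v.2 fun e => hv (Subtype.ext e)).notMem_cone w)

theorem swapHomeo_mem [NeZero q] {u v : Vertex q r} (h : Disj u v) :
    swapHomeo u v h ∈ higmanThompsonGroup q r := by
  obtain ⟨A, hu, hv⟩ := exists_leaves_pair h
  exact ⟨A, A, _, represents_swapHomeo A ⟨u, hu⟩ ⟨v, hv⟩ h⟩

open Classical in
/-- The element of the Higman–Thompson group that swaps the cones of `u` and `v` if these vertices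
are disjoint. -/
noncomputable def sw [NeZero q] (u v : Vertex q r) : higmanThompsonGroup q r :=
  if h : Disj u v then ⟨swapHomeo u v h, swapHomeo_mem h⟩ else 1

section

variable [NeZero q] {u v : Vertex q r}

theorem sw_val (h : Disj u v) : (sw u v).1 = swapHomeo u v h := by
  rw [sw, dif_pos h]

theorem sw_maps_left (h : Disj u v) : Maps (sw u v).1 u v := by
  intro w
  rw [sw_val h]
  exact swapFun_left u v w

theorem sw_maps_right (h : Disj u v) : Maps (sw u v).1 v u := by
  intro w
  rw [sw_val h]
  exact swapFun_right h w

theorem sw_apply_of_notMem {x : Boundary q r} (hu : x ∉ cone u) (hv : x ∉ cone v) :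
    (sw u v).1 x = x := by
  by_cases h : Disj u v
  · rw [sw_val h]
    exact swapFun_of_notMem hu hv
  · rw [sw, dif_neg h]
    rfl

theorem sw_maps_of_disj {x : Vertex q r} (hu : Disj x u) (hv : Disj x v) :
    Maps (sw u v).1 x x :=
  fun w => sw_apply_of_notMem (hu.notMem_cone w) (hv.notMem_cone w)

theorem sw_mul_self (u v : Vertex q r) : sw u v * sw u v = 1 := by
  by_cases h : Disj u v
  · refine group_ext fun x => ?_
    rw [sw, dif_pos h]
    exact swapFun_swapFun h x
  · rw [sw, dif_neg h, one_mul]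

theorem sw_inv (u v : Vertex q r) : (sw u v)⁻¹ = sw u v :=
  inv_eq_of_mul_eq_one_left (sw_mul_self u v)

/-- The commutation and three-cycle relations among swaps are all drawn from this identity. -/
theorem conj_sw {g : higmanThompsonGroup q r} {u' v' : Vertex q r} (hu : Maps g.1 u u')
    (hv : Maps g.1 v v') (h : Disj u v) : g * sw u v * g⁻¹ = sw u' v' := by
  rw [mul_inv_eq_iff_eq_mul]
  have h' : Disj u' v' := hu.disj hv h
  refine group_ext fun x => ?_
  change g.1 ((sw u v).1 x) = (sw u' v').1 (g.1 x)
  by_cases hxu : x ∈ cone u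
  · obtain ⟨w, rfl⟩ := hxu
    rw [sw_maps_left h, hu, hv, sw_maps_left h']
  · by_cases hxv : x ∈ cone v
    · obtain ⟨w, rfl⟩ := hxv
      rw [sw_maps_right h, hu, hv, sw_maps_right h']
    · rw [sw_apply_of_notMem hxu hxv, sw_apply_of_notMem]
      · rintro ⟨w, hw⟩
        rw [← hu] at hw
        exact hxu ⟨w, g.1.injective hw⟩
      · rintro ⟨w, hw⟩
        rw [← hv] at hw
        exact hxv ⟨w, g.1.injective hw⟩

theorem sw_comm (u v : Vertex q r) : sw u v = sw v u := by
  by_cases h : Disj u v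
  · have := conj_sw (sw_maps_left h) (sw_maps_right h) h
    rw [sw_inv, sw_mul_self, one_mul] at this
    exact this
  · rw [sw, sw, dif_neg h, dif_neg fun h' => h h'.symm]

theorem sw_commute {x y : Vertex q r} (hxu : Disj x u) (hxv : Disj x v) (hyu : Disj y u)
    (hyv : Disj y v) (h : Disj x y) : Commute (sw u v) (sw x y) := by
  have := conj_sw (sw_maps_of_disj hxu hxv) (sw_maps_of_disj hyu hyv) h
  rwa [mul_inv_eq_iff_eq_mul] at this

/-- The behaviour off the listed children is part of the induction: the swap of a new pair of
children is composed with a product that must fix that pair. -/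
theorem list_prod_sw (h : Disj u v) (l : List (Fin q)) (hl : l.Nodup) :
    (∀ a ∈ l, Maps (l.map fun a => sw (u.extend [a]) (v.extend [a])).prod.1
        (u.extend [a]) (v.extend [a]) ∧
      Maps (l.map fun a => sw (u.extend [a]) (v.extend [a])).prod.1
        (v.extend [a]) (u.extend [a])) ∧
    ∀ x, (∀ a ∈ l, x ∉ cone (u.extend [a]) ∧ x ∉ cone (v.extend [a])) →
      (l.map fun a => sw (u.extend [a]) (v.extend [a])).prod.1 x = x := by
  induction l with
  | nil => exact ⟨by simp, fun x _ => rfl⟩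
  | cons b l ih =>
    rw [List.nodup_cons] at hl
    obtain ⟨ih1, ih2⟩ := ih hl.2
    simp only [List.map_cons, List.prod_cons]
    have hb := h.extend [b] [b]
    refine ⟨fun a ha => ?_, fun x hx => ?_⟩
    · rcases List.mem_cons.1 ha with rfl | ha
      · have key : ∀ y ∈ l, ∀ w, (u.extend [a]).ray w ∉ cone (u.extend [y]) ∧
            (u.extend [a]).ray w ∉ cone (v.extend [y]) ∧
            (v.extend [a]).ray w ∉ cone (u.extend [y]) ∧
            (v.extend [a]).ray w ∉ cone (v.extend [y]) := by
          intro y hy w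
          have hne : a ≠ y := fun e => hl.1 (e ▸ hy)
          exact ⟨(disj_children u hne).notMem_cone w, (h.extend _ _).notMem_cone w,
            (h.symm.extend _ _).notMem_cone w, (disj_children v hne).notMem_cone w⟩
        constructor
        · refine (sw_maps_left hb).mul fun w => ih2 _ fun y hy => ?_
          exact ⟨(key y hy w).1, (key y hy w).2.1⟩
        · refine (sw_maps_right hb).mul fun w => ih2 _ fun y hy => ?_
          exact ⟨(key y hy w).2.2.1, (key y hy w).2.2.2⟩
      · have hne : a ≠ b := fun e => hl.1 (e ▸ ha)
        exact ⟨(sw_maps_of_disj (h.symm.extend _ _) (disj_children v hne)).mul (ih1 a ha).1,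
          (sw_maps_of_disj (disj_children u hne) (h.extend _ _)).mul (ih1 a ha).2⟩
    · have e : (l.map fun a => sw (u.extend [a]) (v.extend [a])).prod.1 x = x :=
        ih2 x fun a ha => hx a (List.mem_cons_of_mem _ ha)
      change (sw _ _).1 ((l.map fun a => sw (u.extend [a]) (v.extend [a])).prod.1 x) = x
      rw [e]
      exact sw_apply_of_notMem (hx b List.mem_cons_self).1 (hx b List.mem_cons_self).2

theorem sw_eq_prod (h : Disj u v) :
    sw u v = ((List.finRange q).map fun a => sw (u.extend [a]) (v.extend [a])).prod := by
  obtain ⟨h1, h2⟩ := list_prod_sw h (List.finRange q) (List.nodup_finRange q)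
  refine group_ext fun x => ?_
  by_cases hu : x ∈ cone u
  · obtain ⟨w, rfl⟩ := hu
    rw [sw_maps_left h, u.ray_eq_child, v.ray_eq_child, (h1 _ (List.mem_finRange _)).1]
  · by_cases hv : x ∈ cone v
    · obtain ⟨w, rfl⟩ := hv
      rw [sw_maps_right h, u.ray_eq_child, v.ray_eq_child, (h1 _ (List.mem_finRange _)).2]
    · rw [sw_apply_of_notMem hu hv, h2 x]
      refine fun a _ => ⟨?_, ?_⟩
      · rintro ⟨w, rfl⟩
        exact hu ⟨_, (Vertex.ray_extend _ _ _).symm⟩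
      · rintro ⟨w, rfl⟩
        exact hv ⟨_, (Vertex.ray_extend _ _ _).symm⟩

end

/-! ### Generation by swaps -/

/-- The set of all swaps of two disjoint cones. -/
def swaps (q r : ℕ) [NeZero q] : Set (higmanThompsonGroup q r) :=
  {g | ∃ u v, Disj u v ∧ g = sw u v}

namespace FiniteSubforest

theorem eq_of_verts_eq {A B : FiniteSubforest q r} (h : A.verts = B.verts) : A = B := by
  cases A
  cases B
  cases h
  rfl

/-- The subforest `A` has a vertex `p` all of whose children are leaves. -/
def IsCaret (A : FiniteSubforest q r) (p : Vertex q r) : Prop :=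
  ∀ a : Fin q, p.extend [a] ∈ A.leaves

/-- The siblings of a vertex of maximal depth are all leaves, so its parent carries a caret. -/
theorem eq_roots_or_exists_isCaret (A : FiniteSubforest q r) :
    A = roots q r ∨ ∃ p, A.IsCaret p := by
  by_cases h : ∃ v ∈ A.verts, v.path ≠ []
  · right
    obtain ⟨v₀, hv₀, hne₀⟩ := h
    obtain ⟨v, hv, hmax⟩ := A.verts.exists_max_image (fun v => v.path.length) ⟨v₀, hv₀⟩
    have hne : v.path ≠ [] := by
      intro e
      have := hmax v₀ hv₀
      simp only [e, List.length_nil] at this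
      exact hne₀ (List.length_eq_zero_iff.1 (by omega))
    obtain ⟨i, l⟩ := v
    rcases List.eq_nil_or_concat' l with rfl | ⟨l, a, rfl⟩
    · exact absurd rfl hne
    · refine ⟨⟨i, l⟩, fun b => (A.mem_leaves _).2
        ⟨A.sibling_mem ⟨i, l⟩ a b hv, fun c hc => ?_⟩⟩
      have := hmax _ hc
      simp [Vertex.extend] at this
  · left
    push Not at h
    refine eq_of_verts_eq (Finset.ext fun v => ⟨fun hv => ?_, fun hv => ?_⟩)
    · exact Finset.mem_image.2 ⟨v.tree, Finset.mem_univ _, Vertex.ext rfl (h v hv).symm⟩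
    · obtain ⟨i, -, rfl⟩ := Finset.mem_image.1 hv
      exact A.root_mem i

theorem card_leaves_roots_le (q r : ℕ) : (roots q r).leaves.card ≤ r :=
  (Finset.card_filter_le _ _).trans (Finset.card_image_le.trans (by simp))

/-- Every tree has a leaf, and the tree of `p` keeps one after a child of `p` is discarded. Counting
leaves thus separates the roots from all other subforests. -/
theorem lt_card_leaves_of_isCaret (hq : 2 ≤ q) {A : FiniteSubforest q r} {p : Vertex q r}
    (h : A.IsCaret p) : r < A.leaves.card := by
  have : NeZero q := ⟨by omega⟩
  have hsub : (Finset.univ : Finset (Fin r)) ⊆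
      (A.leaves.erase (p.extend [0])).image Vertex.tree := by
    intro i _
    rw [Finset.mem_image]
    by_cases hi : i = p.tree
    · refine ⟨p.extend [⟨1, by omega⟩], Finset.mem_erase.2 ⟨fun e => ?_, h _⟩, hi.symm⟩
      have := extend_singleton_injective p e
      simp [Fin.ext_iff] at this
    · obtain ⟨v, hv, w, hw⟩ := A.exists_leaf_ray (i, fun _ => 0)
      have hvi : v.tree = i := congrArg Prod.fst hw
      refine ⟨v, Finset.mem_erase.2 ⟨?_, hv⟩, hvi⟩
      rintro rfl
      exact hi hvi.symm
  have h1 := (Finset.card_le_card hsub).trans Finset.card_image_le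
  rw [Finset.card_univ, Fintype.card_fin, Finset.card_erase_of_mem (h 0)] at h1
  have h2 : 0 < A.leaves.card := Finset.card_pos.2 ⟨_, h 0⟩
  omega

open Classical in
/-- The subforest obtained by removing the children of a vertex all of whose children are
leaves. -/
noncomputable def removeCaret (A : FiniteSubforest q r) (p : Vertex q r) (h : A.IsCaret p) :
    FiniteSubforest q r where
  verts := A.verts.filter fun v => ∀ a, v ≠ p.extend [a]
  root_mem i := Finset.mem_filter.2 ⟨A.root_mem i, fun a e => by
    have := congrArg Vertex.path e
    simp [Vertex.extend] at this⟩
  parent_mem v a hv := by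
    rw [Finset.mem_filter] at hv ⊢
    refine ⟨A.parent_mem v a hv.1, ?_⟩
    rintro b rfl
    exact ((A.mem_leaves _).1 (h b)).2 a hv.1
  sibling_mem v a b hv := by
    rw [Finset.mem_filter] at hv ⊢
    refine ⟨A.sibling_mem v a b hv.1, fun c hc => ?_⟩
    obtain rfl := Vertex.extend_singleton_inj hc
    exact hv.2 a rfl

theorem mem_removeCaret {A : FiniteSubforest q r} {p : Vertex q r} {h : A.IsCaret p}
    {v : Vertex q r} : v ∈ (A.removeCaret p h).verts ↔ v ∈ A.verts ∧ ∀ a, v ≠ p.extend [a] := by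
  simp [removeCaret]

theorem removeCaret_card_lt [NeZero q] (A : FiniteSubforest q r) (p : Vertex q r)
    (h : A.IsCaret p) : (A.removeCaret p h).verts.card < A.verts.card := by
  refine Finset.card_lt_card ⟨fun v hv => (mem_removeCaret.1 hv).1, fun hsub => ?_⟩
  exact (mem_removeCaret.1 (hsub ((A.mem_leaves _).1 (h 0)).1)).2 0 rfl

theorem mem_leaves_removeCaret {A : FiniteSubforest q r} {p : Vertex q r} {h : A.IsCaret p}
    {v : Vertex q r} (hv : v ∈ (A.removeCaret p h).leaves) : v = p ∨ v ∈ A.leaves := by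
  rw [mem_leaves] at hv
  by_cases hp : v = p
  · exact Or.inl hp
  · refine Or.inr ((A.mem_leaves _).2 ⟨(mem_removeCaret.1 hv.1).1, fun a ha => ?_⟩)
    exact hv.2 a (mem_removeCaret.2 ⟨ha, fun b e => hp (Vertex.extend_singleton_inj e)⟩)

theorem exists_perm_of_leaves [NeZero q] (A : FiniteSubforest q r) (π : Equiv.Perm A.leaves) :
    ∃ t ∈ Subgroup.closure (swaps q r), Represents A A π t.1 := by
  induction π using Equiv.Perm.swap_induction_on with
  | one => exact ⟨1, one_mem _, fun _ _ => rfl⟩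
  | swap_mul f x y hxy ih =>
    obtain ⟨t, ht, H⟩ := ih
    have hd : Disj x.1 y.1 := A.leaves_disj x.2 y.2 fun e => hxy (Subtype.ext e)
    refine ⟨sw x.1 y.1 * t, mul_mem (Subgroup.subset_closure ⟨_, _, hd, rfl⟩) ht, fun v w => ?_⟩
    change (sw x.1 y.1).1 (t.1 _) = _
    rw [H, sw_val hd, represents_swapHomeo]
    rfl

end FiniteSubforest

open FiniteSubforest

/-- The induction is on the size of the domain only; the codomain is rebuilt by `exists_represents`
each time a caret is removed. -/
theorem mem_closure_swaps (hq : 2 ≤ q) [NeZero q] (n : ℕ) (A B : FiniteSubforest q r)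
    (e : A.leaves ≃ B.leaves) (g : higmanThompsonGroup q r) (hn : A.verts.card = n)
    (H : Represents A B e g.1) : g ∈ Subgroup.closure (swaps q r) := by
  induction n using Nat.strong_induction_on generalizing A B g with
  | _ n ih =>
    -- Equal leaf counts exclude that exactly one of `A`, `B` consists of the roots.
    have hcard : A.leaves.card = B.leaves.card := Finset.card_eq_of_equiv e
    have hroots := card_leaves_roots_le q r
    rcases A.eq_roots_or_exists_isCaret with rfl | ⟨p, hp⟩
    · rcases B.eq_roots_or_exists_isCaret with rfl | ⟨p', hp'⟩
      · obtain ⟨t, ht, Ht⟩ := exists_perm_of_leaves _ e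
        have : g = t := Subtype.ext <| FiniteSubforest.homeomorph_ext _ fun v hv w =>
          (H ⟨v, hv⟩ w).trans (Ht ⟨v, hv⟩ w).symm
        rwa [this]
      · have := lt_card_leaves_of_isCaret hq hp'
        omega
    · rcases B.eq_roots_or_exists_isCaret with rfl | ⟨p', hp'⟩
      · have := lt_card_leaves_of_isCaret hq hp
        omega
      · let x : Fin q ↪ B.leaves := ⟨fun a => e ⟨p.extend [a], hp a⟩, fun a b hab =>
          extend_singleton_injective p (congrArg Subtype.val (e.injective hab))⟩
        let y : Fin q ↪ B.leaves := ⟨fun a => ⟨p'.extend [a], hp' a⟩, fun a b hab =>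
          extend_singleton_injective p' (congrArg Subtype.val hab)⟩
        -- Multiple transitivity gives a leaf permutation that takes the image of the caret at `p`
        -- to the caret at `p'` in order; the corrected element then acts canonically on the whole
        -- cone of `p`.
        obtain ⟨π, hπ⟩ := (Equiv.Perm.isMultiplyPretransitive B.leaves q).exists_smul_eq x y
        obtain ⟨t, ht, Ht⟩ := exists_perm_of_leaves B π
        have hmaps : ∀ v ∈ (A.removeCaret p hp).leaves, ∃ u, Maps (t * g).1 v u := by
          intro v hv
          rcases mem_leaves_removeCaret hv with rfl | hv
          · refine ⟨p', fun w => ?_⟩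
            rw [v.ray_eq_child, p'.ray_eq_child]
            change t.1 (g.1 _) = _
            rw [H ⟨_, hp (w 0)⟩, Ht]
            exact congrArg (fun z : B.leaves => z.1.ray fun i => w (i + 1))
              (DFunLike.congr_fun hπ (w 0))
          · exact ⟨_, (Ht.maps _).mul (H.maps ⟨v, hv⟩)⟩
        obtain ⟨B', e', H'⟩ := exists_represents _ _ hmaps
        have := ih _ (hn ▸ A.removeCaret_card_lt p hp) _ _ e' (t * g) rfl H'
        exact (Subgroup.mul_mem_cancel_left _ ht).1 this

theorem closure_swaps (hq : 2 ≤ q) [NeZero q] : Subgroup.closure (swaps q r) = ⊤ := by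
  refine eq_top_iff.2 fun g _ => ?_
  obtain ⟨A, B, e, H⟩ := g.2
  exact mem_closure_swaps hq _ A B e g rfl H

/-! ### The sign -/

/-- Neither word is a prefix of the other, so a first difference decides and the suffixes are
irrelevant. -/
theorem list_append_lt_append_iff {α : Type*} [LinearOrder α] {l l' : List α} (m m' : List α)
    (h : ∀ n, l' ≠ l ++ n) (h' : ∀ n, l ≠ l' ++ n) : l ++ m < l' ++ m' ↔ l < l' := by
  induction l generalizing l' with
  | nil => exact absurd rfl (h l')
  | cons a l ih =>
    cases l' with
    | nil => exact absurd rfl (h' (a :: l))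
    | cons b l' =>
      simp only [List.cons_append, List.cons_lt_cons_iff]
      refine or_congr_right (and_congr_right fun hab => ?_)
      subst hab
      exact ih (fun n e => h n (by rw [e]; rfl)) (fun n e => h' n (by rw [e]; rfl))

theorem list_append_lt_append_left_iff {α : Type*} [LinearOrder α] (l m m' : List α) :
    l ++ m < l ++ m' ↔ m < m' := by
  induction l with
  | nil => rfl
  | cons a l ih => simpa [List.cons_lt_cons_iff] using ih

theorem Vertex.lt_iff {v w : Vertex q r} :
    v < w ↔ v.tree < w.tree ∨ v.tree = w.tree ∧ v.path < w.path :=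
  Prod.Lex.lt_iff

theorem Disj.extend_lt_extend_iff [NeZero q] {u v : Vertex q r} (h : Disj u v)
    (m m' : List (Fin q)) : u.extend m < v.extend m' ↔ u < v := by
  rw [Vertex.lt_iff, Vertex.lt_iff]
  refine or_congr_right (and_congr_right fun ht => ?_)
  have key : ∀ {u v : Vertex q r}, Disj u v → u.tree = v.tree → ∀ n, v.path ≠ u.path ++ n := by
    intro u v h ht n e
    have : v = u.extend n := Vertex.ext ht.symm e
    refine h (prepend n fun _ => 0) (fun _ => 0) ?_
    rw [this, Vertex.ray_extend]
  exact list_append_lt_append_iff m m' (key h ht) (key h.symm ht.symm)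

theorem Vertex.extend_lt_extend_left_iff (u : Vertex q r) (m m' : List (Fin q)) :
    u.extend m < u.extend m' ↔ m < m' := by
  rw [Vertex.lt_iff]
  simp [Vertex.extend, list_append_lt_append_left_iff]

/-- An odd power of a sign is that sign. -/
theorem prod_comp_of_odd_card {α β : Type*} [Fintype α] [Fintype β] [DecidableEq α] (p : β → α)
    (h : ∀ a, Odd (Finset.univ.filter fun x => p x = a).card) (f : α → ℤˣ) :
    ∏ x, f (p x) = ∏ a, f a := by
  rw [← Finset.prod_fiberwise' Finset.univ p]
  refine Finset.prod_congr rfl fun a _ => ?_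
  rw [Finset.prod_const, Int.units_pow_eq_pow_mod_two, Nat.odd_iff.1 (h a), pow_one]

/-- Counting inversions directly on leaves removes the numbering; letting `y` range over all leaves
allows both products to be regrouped by fibres. -/
theorem sign_treePerm_eq_prod (A B : FiniteSubforest q r) (e : A.leaves ≃ B.leaves) :
    Equiv.Perm.sign (treePerm A B e) =
      ∏ x : A.leaves, ∏ y : A.leaves, if x < y ∧ ¬ e x < e y then -1 else 1 := by
  rw [Equiv.Perm.sign_eq_prod_prod_Ioi]
  refine Fintype.prod_equiv (A.leaves.orderIsoOfFin rfl).toEquiv _ _ fun i => ?_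
  rw [← Finset.filter_lt_eq_Ioi, Finset.prod_filter]
  refine Fintype.prod_equiv (A.leaves.orderIsoOfFin rfl).toEquiv _ _ fun j => ?_
  have h1 : (A.leaves.orderIsoOfFin rfl).toEquiv i < (A.leaves.orderIsoOfFin rfl).toEquiv j ↔
      i < j := (A.leaves.orderIsoOfFin rfl).lt_iff_lt
  have h2 : treePerm A B e i < treePerm A B e j ↔
      e ((A.leaves.orderIsoOfFin rfl).toEquiv i) < e ((A.leaves.orderIsoOfFin rfl).toEquiv j) :=
    (B.leaves.orderIsoOfFin (Finset.card_eq_of_equiv e).symm).symm.lt_iff_lt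
  refine Eq.trans ?_ (if_congr (and_congr h1 (not_congr h2.symm)) rfl rfl).symm
  by_cases hij : i < j <;> by_cases ht : treePerm A B e i < treePerm A B e j <;> simp [hij, ht]

theorem sign_treePerm_self (A : FiniteSubforest q r) (π : Equiv.Perm A.leaves) :
    Equiv.Perm.sign (treePerm A A π) = Equiv.Perm.sign π :=
  Equiv.Perm.sign_trans_trans_symm π _

theorem sign_treePerm_trans (A B C : FiniteSubforest q r) (e : A.leaves ≃ B.leaves)
    (f : B.leaves ≃ C.leaves) : Equiv.Perm.sign (treePerm A C (e.trans f)) =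
      Equiv.Perm.sign (treePerm B C f) * Equiv.Perm.sign (treePerm A B e) := by
  -- The two permutations act on `Fin` of cardinals that are only propositionally equal; a free `n`
  -- makes the comparison definitional.
  have key : ∀ (n : ℕ) (hB : B.leaves.card = n) (hC : C.leaves.card = n),
      Equiv.Perm.sign (((B.leaves.orderIsoOfFin hB).toEquiv.trans f).trans
        (C.leaves.orderIsoOfFin hC).toEquiv.symm) = Equiv.Perm.sign (treePerm B C f) := by
    rintro n rfl hC
    rfl
  rw [← key A.leaves.card (Finset.card_eq_of_equiv e).symm
    (Finset.card_eq_of_equiv (e.trans f)).symm, ← Equiv.Perm.sign_mul]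
  congr 1
  ext i
  simp [treePerm]

theorem FiniteSubforest.mem_leaves_ball [NeZero q] {d : ℕ} {v : Vertex q r} :
    v ∈ (truncate ∅ d : FiniteSubforest q r).leaves ↔ v.path.length = d := by
  rw [mem_leaves_truncate (by simp) (by simp)]
  simp

/-- Send each vertex of depth `d` to the leaf of `A` above it. Inversions are pulled back along this
map, whose fibres have odd size, so their parity is unchanged. -/
theorem sign_treePerm_ball (hq : 2 ≤ q) (hodd : Odd q) {A B C : FiniteSubforest q r} {d : ℕ}
    (hd : ∀ v ∈ A.verts, v.path.length < d) {e : A.leaves ≃ B.leaves}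
    {f : (FiniteSubforest.truncate ∅ d).leaves ≃ C.leaves} {g : Boundary q r ≃ₜ Boundary q r}
    (H : Represents A B e g) (H' : Represents (FiniteSubforest.truncate ∅ d) C f g) :
    Equiv.Perm.sign (treePerm _ C f) = Equiv.Perm.sign (treePerm A B e) := by
  classical
  have : NeZero q := ⟨by omega⟩
  have hpar : ∀ x : (FiniteSubforest.truncate ∅ d : FiniteSubforest q r).leaves,
      ∃ (u : A.leaves) (m : List (Fin q)), x.1 = u.1.extend m := by
    intro x
    have hx := FiniteSubforest.mem_leaves_ball.1 x.2
    rcases A.mem_or_below_leaf x.1 with h | ⟨u, hu, m, hm⟩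
    · exact absurd (hd _ h) (by omega)
    · exact ⟨⟨u, hu⟩, m, hm⟩
  choose p m hpm using hpar
  have hf : ∀ x, (f x).1 = (e (p x)).1.extend (m x) := fun x =>
    ray_vertex_injective hq fun w => by
      rw [← H' x w, hpm x]
      exact (H.maps (p x)).extend (m x) w
  -- The fibre over `a` is the set of words of length `d - a.1.path.length`, a power of `q` in
  -- number.
  have hcard : ∀ a, Odd (Finset.univ.filter fun x => p x = a).card := by
    intro a
    have had := hd _ ((A.mem_leaves _).1 a.2).1
    have hmem : ∀ l : List.Vector (Fin q) (d - a.1.path.length),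
        a.1.extend l.toList ∈ (FiniteSubforest.truncate ∅ d).leaves := by
      intro l
      rw [FiniteSubforest.mem_leaves_ball, Vertex.length_extend, List.Vector.toList_length]
      omega
    have : (Finset.univ : Finset (List.Vector (Fin q) (d - a.1.path.length))).card =
        (Finset.univ.filter fun x => p x = a).card := by
      refine Finset.card_bij (fun l _ => ⟨a.1.extend l.toList, hmem l⟩) (fun l _ => ?_)
        (fun l _ l' _ h => ?_) (fun x hx => ?_)
      · refine Finset.mem_filter.2 ⟨Finset.mem_univ _, Subtype.ext ?_⟩
        have h := hpm ⟨_, hmem l⟩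
        refine A.leaf_unique _ _ (prepend (m ⟨_, hmem l⟩) fun _ => 0)
          (prepend l.toList fun _ => 0) (p _).2 a.2 ?_
        rw [← Vertex.ray_extend, ← Vertex.ray_extend, ← h]
      · have := congrArg (fun z => (Subtype.val z).path) h
        simp only [Vertex.extend] at this
        exact List.Vector.toList_injective (List.append_cancel_left this)
      · have hx := (Finset.mem_filter.1 hx).2
        subst hx
        have hl : (m x).length = d - (p x).1.path.length := by
          have := FiniteSubforest.mem_leaves_ball.1 x.2
          rw [hpm x, Vertex.length_extend] at this
          omega
        exact ⟨⟨m x, hl⟩, Finset.mem_univ _, Subtype.ext (hpm x).symm⟩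
    rw [← this, Finset.card_univ, card_vector, Fintype.card_fin]
    exact hodd.pow
  rw [sign_treePerm_eq_prod, sign_treePerm_eq_prod,
    ← prod_comp_of_odd_card p hcard]
  refine Finset.prod_congr rfl fun x _ => ?_
  rw [← prod_comp_of_odd_card p hcard]
  refine Finset.prod_congr rfl fun y _ => ?_
  have hlt : (x < y ↔ x.1 < y.1) ∧ (f x < f y ↔ (f x).1 < (f y).1) := ⟨Iff.rfl, Iff.rfl⟩
  refine if_congr ?_ rfl rfl
  rw [hlt.1, hlt.2, hf, hf]
  conv_lhs => rw [hpm x, hpm y]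
  -- Below one leaf the order is preserved, so neither side has an inversion; below distinct leaves
  -- it is the order of these leaves.
  rcases eq_or_ne (p x) (p y) with h | h
  · rw [h, Vertex.extend_lt_extend_left_iff, Vertex.extend_lt_extend_left_iff]
    simp
  · have h1 : Disj (p x).1 (p y).1 :=
      A.leaves_disj (p x).2 (p y).2 fun h' => h (Subtype.ext h')
    rw [h1.extend_lt_extend_iff, ((H.maps (p x)).disj (H.maps (p y)) h1).extend_lt_extend_iff]
    rfl

/-- Both representatives are compared with one on a ball deeper than both domains. -/
theorem Represents.sign_treePerm_eq (hq : 2 ≤ q) (hodd : Odd q) {A B A' B' : FiniteSubforest q r}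
    {e : A.leaves ≃ B.leaves} {e' : A'.leaves ≃ B'.leaves} {g : Boundary q r ≃ₜ Boundary q r}
    (H : Represents A B e g) (H' : Represents A' B' e' g) :
    Equiv.Perm.sign (treePerm A B e) = Equiv.Perm.sign (treePerm A' B' e') := by
  have : NeZero q := ⟨by omega⟩
  obtain ⟨d₁, h₁⟩ := A.exists_length_lt
  obtain ⟨d₂, h₂⟩ := A'.exists_length_lt
  have h₁' : ∀ v ∈ A.verts, v.path.length < max d₁ d₂ := fun v hv =>
    (h₁ v hv).trans_le (le_max_left _ _)
  have h₂' : ∀ v ∈ A'.verts, v.path.length < max d₁ d₂ := fun v hv =>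
    (h₂ v hv).trans_le (le_max_right _ _)
  obtain ⟨C, f, Hf⟩ := exists_represents (FiniteSubforest.truncate ∅ (max d₁ d₂)) g
    fun v hv => by
      have hv := FiniteSubforest.mem_leaves_ball.1 hv
      rcases A.mem_or_below_leaf v with h | ⟨u, hu, m, rfl⟩
      · exact absurd (h₁' _ h) (by omega)
      · exact ⟨_, (H.maps ⟨u, hu⟩).extend m⟩
  rw [← sign_treePerm_ball hq hodd h₁' H Hf, ← sign_treePerm_ball hq hodd h₂' H' Hf]

/-- The codomain of `h` and the domain of `g` are both refined to their union. -/
theorem exists_represents_mul [NeZero q] (g h : higmanThompsonGroup q r) :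
    ∃ (A B C : FiniteSubforest q r) (e : A.leaves ≃ B.leaves) (f : B.leaves ≃ C.leaves),
      Represents A B e h.1 ∧ Represents B C f g.1 := by
  obtain ⟨A, B, e, H⟩ := h.2
  obtain ⟨C, D, f, K⟩ := g.2
  obtain ⟨A', e', H'⟩ := H.refine (B.union C) Finset.subset_union_left
  obtain ⟨D', f', K'⟩ := K.symm.refine (B.union C) Finset.subset_union_right
  exact ⟨A', _, D', e', f'.symm, H', K'.symm⟩

theorem exists_isTheta (hq : 2 ≤ q) : ∃ θ : higmanThompsonGroup q r →* ℤˣ, IsTheta θ := by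
  rcases Nat.even_or_odd q with he | ho
  · exact ⟨1, fun _ => rfl, fun h => absurd he (Nat.not_even_iff_odd.2 h)⟩
  · have : NeZero q := ⟨by omega⟩
    choose A B e H using fun g : higmanThompsonGroup q r => g.2
    refine ⟨MonoidHom.mk' (fun g => Equiv.Perm.sign (treePerm (A g) (B g) (e g))) fun g h => ?_,
      fun h => absurd h (Nat.not_even_iff_odd.2 ho), fun _ g A' B' e' H' =>
        (H g).sign_treePerm_eq hq ho H'⟩
    obtain ⟨X, Y, Z, a, b, Ha, Hb⟩ := exists_represents_mul g h
    have Hab : Represents X Z (a.trans b) (g * h).1 := fun v w => by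
      change g.1 (h.1 _) = _
      rw [Ha, Hb]
      rfl
    rw [(H (g * h)).sign_treePerm_eq hq ho Hab, (H g).sign_treePerm_eq hq ho Hb,
      (H h).sign_treePerm_eq hq ho Ha, sign_treePerm_trans]

theorem IsTheta.eq {θ θ' : higmanThompsonGroup q r →* ℤˣ} (h : IsTheta θ) (h' : IsTheta θ') :
    θ = θ' := by
  rcases Nat.even_or_odd q with he | ho
  · rw [h.1 he, h'.1 he]
  · ext1 g
    obtain ⟨A, B, e, H⟩ := g.2
    rw [h.2 ho g A B e H, h'.2 ho g A B e H]

theorem IsTheta.apply_sw [NeZero q] (hodd : Odd q) {θ : higmanThompsonGroup q r →* ℤˣ}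
    (h : IsTheta θ) {u v : Vertex q r} (huv : Disj u v) : θ (sw u v) = -1 := by
  obtain ⟨A, hu, hv⟩ := exists_leaves_pair huv
  have H := represents_swapHomeo A ⟨u, hu⟩ ⟨v, hv⟩ huv
  rw [← sw_val huv] at H
  rw [h.2 hodd _ _ _ _ H, sign_treePerm_self,
    Equiv.Perm.sign_swap fun e => huv.ne (congrArg Subtype.val e)]

/-! ### Normal subgroups -/

/-- The subgroup generated by the products of two swaps. -/
def evenSubgroup (q r : ℕ) [NeZero q] : Subgroup (higmanThompsonGroup q r) :=
  Subgroup.closure {g | ∃ s ∈ swaps q r, ∃ t ∈ swaps q r, g = s * t}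

theorem sw_mul_sw_mem [NeZero q] {u v u' v' : Vertex q r} (h : Disj u v) (h' : Disj u' v') :
    sw u v * sw u' v' ∈ evenSubgroup q r :=
  Subgroup.subset_closure ⟨_, ⟨_, _, h, rfl⟩, _, ⟨_, _, h', rfl⟩, rfl⟩

/-- A product of an even number of elements of `S` lies in every subgroup that contains the products
of two elements of `S`. -/
theorem list_prod_mem_of_even {G : Type*} [Group G] {S : Set G} {N : Subgroup G}
    (h : ∀ s ∈ S, ∀ t ∈ S, s * t ∈ N) :
    ∀ l : List G, (∀ s ∈ l, s ∈ S) → Even l.length → l.prod ∈ N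
  | [], _, _ => one_mem N
  | [_], _, he => absurd he (by simp)
  | s :: t :: l, hl, he => by
    rw [List.prod_cons, List.prod_cons, ← mul_assoc]
    refine mul_mem (h s (hl s (by simp)) t (hl t (by simp)))
      (list_prod_mem_of_even h l (fun x hx => hl x (by simp [hx])) ?_)
    simpa [Nat.even_add_one] using he

/-! ### Room for disjoint cones -/

/-- Pigeonhole: a vertex of depth at least `4` blocks at most one of the `q ^ 4 ≥ 16` vertices of
depth `4` in the first tree. -/
theorem exists_disj_of_length_lt (hq : 2 ≤ q) (hr : 1 ≤ r) (l : List (Vertex q r))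
    (hl : ∀ v ∈ l, 4 ≤ v.path.length) (hlen : l.length < 16) :
    ∃ p : Vertex q r, 4 ≤ p.path.length ∧ ∀ v ∈ l, Disj p v := by
  classical
  have hcard : (l.toFinset.image fun v => v.path.take 4).card <
      ((Finset.univ : Finset (List.Vector (Fin q) 4)).image List.Vector.toList).card := by
    rw [Finset.card_image_of_injective _ List.Vector.toList_injective, Finset.card_univ, card_vector,
      Fintype.card_fin]
    have h1 : 2 ^ 4 ≤ q ^ 4 := Nat.pow_le_pow_left hq 4
    have h2 := Finset.card_image_le (s := l.toFinset) (f := fun v => v.path.take 4)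
    have h3 := l.toFinset_card_le
    omega
  obtain ⟨m, hm, hm'⟩ := Finset.exists_mem_notMem_of_card_lt_card hcard
  obtain ⟨⟨m, hm4⟩, -, rfl⟩ := Finset.mem_image.1 hm
  change m ∉ _ at hm'
  refine ⟨⟨⟨0, hr⟩, m⟩, hm4.ge, fun v hv w w' e => hm' ?_⟩
  refine Finset.mem_image.2 ⟨v, List.mem_toFinset.2 hv, ?_⟩
  have h4 := hl v hv
  change v.path.take 4 = m
  refine List.ext_getElem (by simp [hm4, h4]) fun i hi hi' => ?_
  have := congrFun (congrArg Prod.snd e) i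
  simp only [Vertex.ray] at this
  rw [prepend_apply_lt _ _ _ hi', prepend_apply_lt _ _ _ (by omega)] at this
  simp [this]

theorem exists_disj_extend {x y : Boundary q r} (h : x ≠ y) (u v : Vertex q r) (w : ℕ → Fin q)
    (hu : u.ray w = x) (hv : v.ray w = y) (d : ℕ) :
    ∃ m, d ≤ m.length ∧ Disj (u.extend m) (v.extend m) := by
  -- For ends in different trees the implication is vacuous, so one index `k` serves both cases.
  obtain ⟨k, hk⟩ : ∃ k, x.1 = y.1 → x.2 k ≠ y.2 k := by
    by_contra! hc
    exact h (Prod.ext (hc 0).1 (funext fun k => (hc k).2))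
  -- The `+ 1` places the index `k` inside the prefix; the summand `d` gives the required length.
  have hm : w = prepend (List.ofFn fun i : Fin (d + k + 1) => w i)
      (fun i => w (d + k + 1 + i)) := by
    have := eq_prepend (List.ofFn fun i : Fin (d + k + 1) => w i) w
      fun i hi => (List.getElem_ofFn hi).symm
    rwa [List.length_ofFn] at this
  set m := List.ofFn fun i : Fin (d + k + 1) => w i with hmdef
  have hml : m.length = d + k + 1 := by simp [hmdef]
  refine ⟨m, by omega, fun w₁ w₂ e => ?_⟩
  have key : ∀ (u : Vertex q r) (w₁ : ℕ → Fin q), ((u.extend m).ray w₁).1 = (u.ray w).1 ∧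
      ((u.extend m).ray w₁).2 k = (u.ray w).2 k := by
    intro u w₁
    refine ⟨rfl, ?_⟩
    have hk : k < (u.extend m).path.length := by
      rw [Vertex.length_extend]
      omega
    rw [hm, ← Vertex.ray_extend]
    exact (prepend_apply_lt _ _ _ hk).trans (prepend_apply_lt _ _ _ hk).symm
  obtain ⟨h1, h2⟩ := key u w₁
  obtain ⟨h3, h4⟩ := key v w₂
  rw [hu] at h1 h2
  rw [hv] at h3 h4
  rw [e] at h1 h2
  exact hk (h1.symm.trans h3) (h2.symm.trans h4)

/-- A sufficiently small cone around an end that is moved is carried canonically off itself. -/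
theorem exists_maps_disj [NeZero q] {g : higmanThompsonGroup q r} (hg : g ≠ 1) :
    ∃ u v, Maps g.1 u v ∧ Disj u v ∧ 4 ≤ u.path.length := by
  obtain ⟨A, B, e, H⟩ := g.2
  obtain ⟨x, hx⟩ : ∃ x, g.1 x ≠ x := by
    by_contra! hc
    exact hg (group_ext hc)
  obtain ⟨v, hv, w, rfl⟩ := A.exists_leaf_ray x
  obtain ⟨m, hm, hd⟩ := exists_disj_extend hx (e ⟨v, hv⟩).1 v w (H ⟨v, hv⟩ w).symm rfl 4
  refine ⟨_, _, (H.maps ⟨v, hv⟩).extend m, hd.symm, ?_⟩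
  rw [Vertex.length_extend]
  omega

/-! ### Three-cycles as commutators -/

section

variable [NeZero q]

/-- The square of a three-cycle is its inverse. The left side is also a commutator of two swaps,
which makes three-cycles commutators. -/
theorem sw_mul_sw_sq {u v w : Vertex q r} (huv : Disj u v) (huw : Disj u w) (hvw : Disj v w) :
    sw u v * sw u w * sw u v * sw u w = sw u w * sw u v := by
  have h1 : sw u v * sw u w * sw u v = sw v w := by
    have := conj_sw (sw_maps_left huv) (sw_maps_of_disj huw.symm hvw.symm) huw
    rwa [sw_inv] at this
  have h2 : sw u w * sw u v * sw u w = sw v w := by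
    have := conj_sw (sw_maps_left huw) (sw_maps_of_disj huv.symm hvw) huv
    rwa [sw_inv, sw_comm w v] at this
  rw [h1, ← h2, mul_assoc, mul_assoc, sw_mul_self, mul_one]

/-- The commutator of two double swaps is a three-cycle. -/
theorem commutator_double_swaps {x₀ x₁ x₂ x₃ x₄ : Vertex q r} (h01 : Disj x₀ x₁) (h02 : Disj x₀ x₂)
    (h12 : Disj x₁ x₂) (h03 : Disj x₀ x₃) (h04 : Disj x₀ x₄) (h13 : Disj x₁ x₃) (h14 : Disj x₁ x₄)
    (h23 : Disj x₂ x₃) (h24 : Disj x₂ x₄) :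
    sw x₀ x₁ * sw x₃ x₄ * (sw x₀ x₂ * sw x₃ x₄) * (sw x₀ x₁ * sw x₃ x₄)⁻¹ *
      (sw x₀ x₂ * sw x₃ x₄)⁻¹ = sw x₀ x₂ * sw x₀ x₁ := by
  -- The factor `sw x₃ x₄` only makes both elements even; it commutes with the other swaps and
  -- cancels.
  have c1 : sw x₃ x₄ * sw x₀ x₁ = sw x₀ x₁ * sw x₃ x₄ := (sw_commute h03 h04 h13 h14 h01).eq
  have c2 : sw x₃ x₄ * sw x₀ x₂ = sw x₀ x₂ * sw x₃ x₄ := (sw_commute h03 h04 h23 h24 h02).eq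
  have s := sw_mul_self x₃ x₄
  rw [← sw_mul_sw_sq h01 h02 h12]
  simp only [mul_inv_rev, sw_inv]
  have e1 : sw x₀ x₁ * sw x₃ x₄ * (sw x₀ x₂ * sw x₃ x₄) = sw x₀ x₁ * sw x₀ x₂ := by
    rw [mul_assoc, ← mul_assoc (sw x₃ x₄), c2, mul_assoc (sw x₀ x₂), s, mul_one]
  have e2 : sw x₃ x₄ * sw x₀ x₁ * (sw x₃ x₄ * sw x₀ x₂) = sw x₀ x₁ * sw x₀ x₂ := by
    rw [c1, mul_assoc, ← mul_assoc (sw x₃ x₄), s, one_mul]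
  rw [e1, mul_assoc, e2, ← mul_assoc]

end

/-- There are five words none of which is a prefix of another one. -/
theorem exists_words (hq : 2 ≤ q) : ∃ m : Fin 5 → List (Fin q),
    ∀ (r : ℕ) (u : Vertex q r) (i j : Fin 5), i ≠ j → Disj (u.extend (m i)) (u.extend (m j)) := by
  have hcard : Fintype.card (Fin 5) ≤ Fintype.card (List.Vector (Fin q) 3) := by
    rw [card_vector, Fintype.card_fin, Fintype.card_fin]
    -- Length three is the least that gives five words for every `q ≥ 2`.
    have : 2 ^ 3 ≤ q ^ 3 := Nat.pow_le_pow_left hq 3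
    omega
  obtain ⟨f⟩ := Function.Embedding.nonempty_of_card_le hcard
  refine ⟨fun i => (f i).1, fun r u i j hij => disj_of_length_eq ?_ fun e => hij (f.injective ?_)⟩
  · rw [Vertex.length_extend, Vertex.length_extend, (f i).2, (f j).2]
  · have := congrArg Vertex.path e
    simp only [Vertex.extend] at this
    exact List.Vector.toList_injective (List.append_cancel_left this)

/-! ### Subgroups normalized by the even subgroup -/

section

variable [NeZero q] {N : Subgroup (higmanThompsonGroup q r)}

/-- Double commutator trick: take `n` in `N` carrying a cone `U` off itself and even `a`, `b`
supported in `U`. Since `n * a * n⁻¹` commutes with `b`, the commutator of `[a, n]` with `b` is `[a,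
b]`, which lies in `N`; double swaps make it a three-cycle. -/
theorem exists_three_cycle_mem (hq : 2 ≤ q)
    (hN : ∀ g ∈ evenSubgroup q r, ∀ n ∈ N, g * n * g⁻¹ ∈ N) (hne : ∃ n ∈ N, n ≠ 1) :
    ∃ u v w : Vertex q r, Disj u v ∧ Disj u w ∧ Disj v w ∧ 4 ≤ u.path.length ∧
      4 ≤ v.path.length ∧ 4 ≤ w.path.length ∧ sw u v * sw u w ∈ N := by
  obtain ⟨n, hn, hn1⟩ := hne
  obtain ⟨U, U', hU, hd, hlen⟩ := exists_maps_disj hn1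
  obtain ⟨m, hm⟩ := exists_words hq
  have D := hm r U
  set x : Fin 5 → Vertex q r := fun i => U.extend (m i) with hx
  have hxl : ∀ i, 4 ≤ (x i).path.length := fun i => by
    rw [hx, Vertex.length_extend]
    omega
  refine ⟨x 0, x 2, x 1, D _ _ (by decide), D _ _ (by decide), D _ _ (by decide), hxl _, hxl _,
    hxl _, ?_⟩
  have d01 := D 0 1 (by decide)
  have d02 := D 0 2 (by decide)
  have d34 := D 3 4 (by decide)
  rw [← commutator_double_swaps d01 d02 (D 1 2 (by decide)) (D 0 3 (by decide))
    (D 0 4 (by decide)) (D 1 3 (by decide)) (D 1 4 (by decide)) (D 2 3 (by decide))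
    (D 2 4 (by decide))]
  set a := sw (x 0) (x 1) * sw (x 3) (x 4) with ha
  set b := sw (x 0) (x 2) * sw (x 3) (x 4) with hb
  have haE : a ∈ evenSubgroup q r := sw_mul_sw_mem d01 d34
  have hbE : b ∈ evenSubgroup q r := sw_mul_sw_mem d02 d34
  set y : Fin 5 → Vertex q r := fun i => U'.extend (m i) with hy
  have hnx : ∀ i, Maps n.1 (x i) (y i) := fun i => hU.extend _
  have hxy : ∀ i j, Disj (y i) (x j) := fun i j => hd.symm.extend _ _
  have hc : n * a * n⁻¹ = sw (y 0) (y 1) * sw (y 3) (y 4) := by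
    rw [← conj_sw (hnx 0) (hnx 1) d01, ← conj_sw (hnx 3) (hnx 4) d34, ha]
    group
  have hDy : ∀ i j, i ≠ j → Disj (y i) (y j) := hm r U'
  -- The two elements are supported in the disjoint cones of `U` and `U'`.
  have hcom : Commute b (n * a * n⁻¹) := by
    have key : ∀ i j k l, k ≠ l → Commute (sw (x i) (x j)) (sw (y k) (y l)) := fun i j k l hkl =>
      sw_commute (hxy _ _) (hxy _ _) (hxy _ _) (hxy _ _) (hDy k l hkl)
    rw [hc, hb]
    exact ((key _ _ _ _ (by decide)).mul_right (key _ _ _ _ (by decide))).mul_left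
      ((key _ _ _ _ (by decide)).mul_right (key _ _ _ _ (by decide)))
  have h1 : a * n * a⁻¹ * n⁻¹ ∈ N := mul_mem (hN a haE n hn) (inv_mem hn)
  have h2 : a * n * a⁻¹ * n⁻¹ * (b * (a * n * a⁻¹ * n⁻¹) * b⁻¹)⁻¹ ∈ N :=
    mul_mem h1 (inv_mem (hN b hbE _ h1))
  have h3 : (n * a⁻¹ * n⁻¹) * b * (n * a * n⁻¹) = b := by
    rw [mul_assoc, hcom.eq]
    group
  have h4 : a * n * a⁻¹ * n⁻¹ * (b * (a * n * a⁻¹ * n⁻¹) * b⁻¹)⁻¹ =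
      a * ((n * a⁻¹ * n⁻¹) * b * (n * a * n⁻¹)) * a⁻¹ * b⁻¹ := by
    group
  rw [h4, h3] at h2
  exact h2

theorem move_three_cycle (hN : ∀ g ∈ evenSubgroup q r, ∀ n ∈ N, g * n * g⁻¹ ∈ N)
    {g : higmanThompsonGroup q r} (hg : g ∈ evenSubgroup q r) {u v w u' v' w' : Vertex q r}
    (hu : Maps g.1 u u') (hv : Maps g.1 v v') (hw : Maps g.1 w w') (huv : Disj u v)
    (huw : Disj u w) (h : sw u v * sw u w ∈ N) : sw u' v' * sw u' w' ∈ N := by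
  have : g * (sw u v * sw u w) * g⁻¹ = sw u' v' * sw u' w' := by
    rw [← conj_sw hu hv huv, ← conj_sw hu hw huw]
    group
  rw [← this]
  exact hN g hg _ h

/-- The three cones of `u`, `v`, `w` are disjoint and small, and `N` contains a cyclic permutation
of them. -/
def ThreeCycleMem (N : Subgroup (higmanThompsonGroup q r)) (u v w : Vertex q r) : Prop :=
  (Disj u v ∧ Disj u w ∧ Disj v w) ∧
    (4 ≤ u.path.length ∧ 4 ≤ v.path.length ∧ 4 ≤ w.path.length) ∧ sw u v * sw u w ∈ N

/-- Conjugating `sw u w` by `sw u v` gives `sw v w`. Rotation reduces every replacement of a cone to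
that of the first one. -/
theorem ThreeCycleMem.rotate {u v w : Vertex q r} (h : ThreeCycleMem N u v w) :
    ThreeCycleMem N v w u := by
  obtain ⟨⟨huv, huw, hvw⟩, ⟨hu, hv, hw⟩, hN⟩ := h
  refine ⟨⟨hvw, huv.symm, huw.symm⟩, ⟨hv, hw, hu⟩, ?_⟩
  have := conj_sw (sw_maps_left huv) (sw_maps_of_disj huw.symm hvw.symm) huw
  rw [mul_inv_eq_iff_eq_mul] at this
  rwa [sw_comm v u, ← this]

/-- Conjugation by `sw u p` would suffice but may be odd; a swap of two further cones `x`, `y`, away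
from everything, corrects the parity. -/
theorem ThreeCycleMem.move (hq : 2 ≤ q) (hr : 1 ≤ r)
    (hN : ∀ g ∈ evenSubgroup q r, ∀ n ∈ N, g * n * g⁻¹ ∈ N) {u v w : Vertex q r}
    (h : ThreeCycleMem N u v w) {p : Vertex q r} (hp : 4 ≤ p.path.length) (hpu : Disj p u)
    (hpv : Disj p v) (hpw : Disj p w) : ThreeCycleMem N p v w := by
  obtain ⟨⟨huv, huw, hvw⟩, ⟨hu, hv, hw⟩, h⟩ := h
  refine ⟨⟨hpv, hpw, hvw⟩, ⟨hp, hv, hw⟩, ?_⟩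
  obtain ⟨x, hx, hxd⟩ := exists_disj_of_length_lt hq hr [u, v, w, p]
    (by simp [hu, hv, hw, hp]) (by simp)
  obtain ⟨y, -, hyd⟩ := exists_disj_of_length_lt hq hr [u, v, w, p, x]
    (by simp [hu, hv, hw, hp, hx]) (by simp)
  simp only [List.mem_cons, List.not_mem_nil, or_false, forall_eq_or_imp, forall_eq] at hxd hyd
  obtain ⟨hxu, hxv, hxw, hxp⟩ := hxd
  obtain ⟨hyu, hyv, hyw, hyp, hyx⟩ := hyd
  exact move_three_cycle hN (sw_mul_sw_mem hpu.symm hyx.symm)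
    ((sw_maps_left hpu.symm).mul (sw_maps_of_disj hxu.symm hyu.symm))
    ((sw_maps_of_disj huv.symm hpv.symm).mul (sw_maps_of_disj hxv.symm hyv.symm))
    ((sw_maps_of_disj huw.symm hpw.symm).mul (sw_maps_of_disj hxw.symm hyw.symm)) huv huw h

/-- The old and new cones may overlap, so the cycle passes through auxiliary cones `x`, `y`, `z`
disjoint from all six. At most eight vertices are avoided at once. -/
theorem ThreeCycleMem.of_disj (hq : 2 ≤ q) (hr : 1 ≤ r)
    (hN : ∀ g ∈ evenSubgroup q r, ∀ n ∈ N, g * n * g⁻¹ ∈ N) {u v w : Vertex q r}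
    (h : ThreeCycleMem N u v w) {u' v' w' : Vertex q r} (hu' : 4 ≤ u'.path.length)
    (hv' : 4 ≤ v'.path.length) (hw' : 4 ≤ w'.path.length) (huv : Disj u' v') (huw : Disj u' w')
    (hvw : Disj v' w') : ThreeCycleMem N u' v' w' := by
  obtain ⟨hu, hv, hw⟩ := h.2.1
  obtain ⟨x, hx, hxd⟩ := exists_disj_of_length_lt hq hr [u, v, w, u', v', w']
    (by simp [*]) (by simp)
  obtain ⟨y, hy, hyd⟩ := exists_disj_of_length_lt hq hr [u, v, w, u', v', w', x]
    (by simp [*]) (by simp)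
  obtain ⟨z, hz, hzd⟩ := exists_disj_of_length_lt hq hr [u, v, w, u', v', w', x, y]
    (by simp [*]) (by simp)
  simp only [List.mem_cons, List.not_mem_nil, or_false, forall_eq_or_imp, forall_eq]
    at hxd hyd hzd
  obtain ⟨xu, xv, xw, xu', xv', xw'⟩ := hxd
  obtain ⟨yu, yv, yw, yu', yv', yw', yx⟩ := hyd
  obtain ⟨zu, zv, zw, zu', zv', zw', zx, zy⟩ := hzd
  have h1 := (h.move hq hr hN hx xu xv xw).rotate
  have h2 := (h1.move hq hr hN hy yv yw yx).rotate
  have h3 := h2.move hq hr hN hz zw zx zy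
  have h4 := (h3.move hq hr hN hu' zu'.symm xu'.symm yu'.symm).rotate
  have h5 := (h4.move hq hr hN hv' xv'.symm yv'.symm huv.symm).rotate
  exact (h5.move hq hr hN hw' yw'.symm huw.symm hvw.symm).rotate

/-- With `x`, `y` disjoint from the rest, the product telescopes into the three-cycles `(u v)(u x)`,
`(u x)(x y)`, `(x y)(x u')`, `(x u')(u' v')`. The two given pairs may overlap. -/
theorem sw_mul_sw_mem_of_small (hq : 2 ≤ q) (hr : 1 ≤ r)
    (hN : ∀ g ∈ evenSubgroup q r, ∀ n ∈ N, g * n * g⁻¹ ∈ N) {a b c : Vertex q r}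
    (h : ThreeCycleMem N a b c) {u v u' v' : Vertex q r} (hu : 4 ≤ u.path.length)
    (hv : 4 ≤ v.path.length) (hu' : 4 ≤ u'.path.length) (hv' : 4 ≤ v'.path.length)
    (huv : Disj u v) (huv' : Disj u' v') : sw u v * sw u' v' ∈ N := by
  obtain ⟨x, hx, hxd⟩ := exists_disj_of_length_lt hq hr [u, v, u', v'] (by simp [*]) (by simp)
  obtain ⟨y, hy, hyd⟩ := exists_disj_of_length_lt hq hr [u, v, u', v', x] (by simp [*]) (by simp)
  simp only [List.mem_cons, List.not_mem_nil, or_false, forall_eq_or_imp, forall_eq] at hxd hyd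
  obtain ⟨xu, xv, xu', xv'⟩ := hxd
  obtain ⟨yu, yv, yu', yv', yx⟩ := hyd
  have h1 : sw u v * sw u x ∈ N := (h.of_disj hq hr hN hu hv hx huv xu.symm xv.symm).2.2
  have h2 : sw x u * sw x y ∈ N := (h.of_disj hq hr hN hx hu hy xu yx.symm yu.symm).2.2
  have h3 : sw x y * sw x u' ∈ N := (h.of_disj hq hr hN hx hy hu' yx.symm xu' yu').2.2
  have h4 : sw u' x * sw u' v' ∈ N := (h.of_disj hq hr hN hu' hx hv' xu'.symm huv' xv').2.2
  rw [sw_comm x u] at h2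
  rw [sw_comm u' x] at h4
  have key : ∀ s t : Vertex q r, ∀ g k : higmanThompsonGroup q r, g * sw s t ∈ N →
      sw s t * k ∈ N → g * k ∈ N := by
    intro s t g k hg hk
    have := mul_mem hg hk
    rwa [mul_assoc, ← mul_assoc (sw s t), sw_mul_self, one_mul] at this
  exact key _ _ _ _ (key _ _ _ _ (key _ _ _ _ h1 h2) h3) h4

/-- Subdivision turns the two swaps into `2 * q` swaps one level deeper, an even number whatever `q`
is. -/
theorem sw_mul_sw_mem_of_succ (d : ℕ)
    (h : ∀ u v u' v' : Vertex q r, d + 1 ≤ u.path.length → d + 1 ≤ v.path.length →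
      d + 1 ≤ u'.path.length → d + 1 ≤ v'.path.length → Disj u v → Disj u' v' →
      sw u v * sw u' v' ∈ N) (u v u' v' : Vertex q r) (hu : d ≤ u.path.length)
    (hv : d ≤ v.path.length) (hu' : d ≤ u'.path.length) (hv' : d ≤ v'.path.length)
    (huv : Disj u v) (huv' : Disj u' v') : sw u v * sw u' v' ∈ N := by
  rw [sw_eq_prod huv, sw_eq_prod huv', ← List.prod_append]
  refine list_prod_mem_of_even (S := {g | ∃ u v : Vertex q r, d + 1 ≤ u.path.length ∧
    d + 1 ≤ v.path.length ∧ Disj u v ∧ g = sw u v}) ?_ _ ?_ (by simp)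
  · rintro _ ⟨x, y, hx, hy, hxy, rfl⟩ _ ⟨x', y', hx', hy', hxy', rfl⟩
    exact h x y x' y' hx hy hx' hy' hxy hxy'
  · intro s hs
    simp only [List.mem_append, List.mem_map] at hs
    rcases hs with ⟨a, -, rfl⟩ | ⟨a, -, rfl⟩
    · exact ⟨_, _, by simp [Vertex.length_extend, hu], by simp [Vertex.length_extend, hv],
        huv.extend _ _, rfl⟩
    · exact ⟨_, _, by simp [Vertex.length_extend, hu'], by simp [Vertex.length_extend, hv'],
        huv'.extend _ _, rfl⟩

/-- Normalization by `evenSubgroup` alone is assumed, so that the result covers subgroups normal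
only in `evenSubgroup`. -/
theorem evenSubgroup_le_of_normalized (hq : 2 ≤ q) (hr : 1 ≤ r)
    (hN : ∀ g ∈ evenSubgroup q r, ∀ n ∈ N, g * n * g⁻¹ ∈ N) (hne : ∃ n ∈ N, n ≠ 1) :
    evenSubgroup q r ≤ N := by
  obtain ⟨a, b, c, h⟩ : ∃ a b c, ThreeCycleMem N a b c := by
    obtain ⟨a, b, c, hab, hac, hbc, ha, hb, hc, h⟩ := exists_three_cycle_mem hq hN hne
    exact ⟨a, b, c, ⟨hab, hac, hbc⟩, ⟨ha, hb, hc⟩, h⟩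
  have h4 := fun (u v u' v' : Vertex q r) (hu : 4 ≤ u.path.length) hv hu' hv' =>
    sw_mul_sw_mem_of_small (v := v) (u' := u') (v' := v') hq hr hN h hu hv hu' hv'
  have h0 := sw_mul_sw_mem_of_succ 0 (sw_mul_sw_mem_of_succ 1 (sw_mul_sw_mem_of_succ 2
    (sw_mul_sw_mem_of_succ 3 h4)))
  refine (Subgroup.closure_le N).2 ?_
  rintro _ ⟨_, ⟨u, v, huv, rfl⟩, _, ⟨u', v', huv', rfl⟩, rfl⟩
  exact h0 u v u' v' (Nat.zero_le _) (Nat.zero_le _) (Nat.zero_le _) (Nat.zero_le _) huv huv'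

end

/-! ### The commutator subgroup -/

theorem exists_three_disj (hq : 2 ≤ q) (hr : 1 ≤ r) :
    ∃ u v w : Vertex q r, Disj u v ∧ Disj u w ∧ Disj v w := by
  obtain ⟨m, hm⟩ := exists_words hq
  exact ⟨_, _, _, hm r ⟨⟨0, hr⟩, []⟩ 0 1 (by decide), hm _ _ 0 2 (by decide),
    hm _ _ 1 2 (by decide)⟩

section

variable [NeZero q]

theorem exists_list_sw (hq : 2 ≤ q) (g : higmanThompsonGroup q r) :
    ∃ l : List (higmanThompsonGroup q r), (∀ s ∈ l, s ∈ swaps q r) ∧ l.prod = g := by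
  have hg : g ∈ (Subgroup.closure (swaps q r)).toSubmonoid := by simp [closure_swaps hq]
  rw [Subgroup.closure_toSubmonoid] at hg
  obtain ⟨l, hl, h⟩ := Submonoid.exists_list_of_mem_closure hg
  refine ⟨l, fun s hs => (hl s hs).elim id ?_, h⟩
  rintro ⟨u, v, huv, h⟩
  exact ⟨u, v, huv, by rw [← sw_inv, ← h, inv_inv]⟩

theorem sw_mem_evenSubgroup (he : Even q) {u v : Vertex q r} (h : Disj u v) :
    sw u v ∈ evenSubgroup q r := by
  rw [sw_eq_prod h]
  refine list_prod_mem_of_even (S := swaps q r) ?_ _ ?_ (by simpa using he)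
  · rintro _ ⟨u, v, huv, rfl⟩ _ ⟨u', v', huv', rfl⟩
    exact sw_mul_sw_mem huv huv'
  · intro s hs
    obtain ⟨a, -, rfl⟩ := List.mem_map.1 hs
    exact ⟨_, _, h.extend _ _, rfl⟩

/-- For odd `q` a product of `k` swaps has value `(-1) ^ k`, so kernel elements are products of
evenly many swaps. For even `q` each swap is itself such a product. -/
theorem IsTheta.ker_eq (hq : 2 ≤ q) {θ : higmanThompsonGroup q r →* ℤˣ} (h : IsTheta θ) :
    θ.ker = evenSubgroup q r := by
  rcases Nat.even_or_odd q with he | ho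
  · rw [h.1 he, MonoidHom.ker_one, eq_comm, eq_top_iff, ← closure_swaps hq, Subgroup.closure_le]
    rintro _ ⟨u, v, huv, rfl⟩
    exact sw_mem_evenSubgroup he huv
  · refine le_antisymm (fun g hg => ?_) ((Subgroup.closure_le _).2 ?_)
    · obtain ⟨l, hl, rfl⟩ := exists_list_sw hq g
      refine list_prod_mem_of_even (S := swaps q r) ?_ l hl ?_
      · rintro _ ⟨u, v, huv, rfl⟩ _ ⟨u', v', huv', rfl⟩
        exact sw_mul_sw_mem huv huv'
      · have hθ : l.map θ = List.replicate l.length (-1) := by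
          refine List.eq_replicate_iff.2 ⟨by simp, fun x hx => ?_⟩
          obtain ⟨s, hs, rfl⟩ := List.mem_map.1 hx
          obtain ⟨u, v, huv, rfl⟩ := hl s hs
          exact h.apply_sw ho huv
        rw [MonoidHom.mem_ker, map_list_prod, hθ, List.prod_replicate] at hg
        by_contra hodd
        rw [Nat.not_even_iff_odd] at hodd
        rw [hodd.neg_one_pow] at hg
        exact absurd hg (by decide)
    · rintro _ ⟨_, ⟨u, v, huv, rfl⟩, _, ⟨u', v', huv', rfl⟩, rfl⟩
      rw [SetLike.mem_coe, MonoidHom.mem_ker, map_mul, h.apply_sw ho huv, h.apply_sw ho huv']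
      rfl

theorem sw_mul_sw_ne_one {u v w : Vertex q r} (huv : Disj u v) (huw : Disj u w)
    (hvw : Disj v w) : sw u w * sw u v ≠ 1 := by
  intro h
  have := (sw_maps_left huw).mul (sw_maps_right huv)
  rw [h] at this
  exact hvw _ _ (this fun _ => 0)

/-- One inclusion holds because the target of `θ` is abelian; the other because the commutator
subgroup is normal and contains a three-cycle. -/
theorem IsTheta.commutator_eq (hq : 2 ≤ q) (hr : 1 ≤ r) {θ : higmanThompsonGroup q r →* ℤˣ}
    (h : IsTheta θ) : commutator (higmanThompsonGroup q r) = evenSubgroup q r := by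
  refine le_antisymm (h.ker_eq hq ▸ Abelianization.commutator_subset_ker θ) ?_
  refine evenSubgroup_le_of_normalized hq hr
    (fun g _ n hn => Subgroup.Normal.conj_mem inferInstance n hn g) ?_
  obtain ⟨u, v, w, huv, huw, hvw⟩ := exists_three_disj (r := r) hq hr
  refine ⟨_, ?_, sw_mul_sw_ne_one huv huw hvw⟩
  rw [← sw_mul_sw_sq huv huw hvw]
  have := Subgroup.commutator_mem_commutator (Subgroup.mem_top (sw u v))
    (Subgroup.mem_top (sw u w))
  rwa [commutatorElement_def, sw_inv, sw_inv] at this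

theorem isSimpleGroup_evenSubgroup (hq : 2 ≤ q) (hr : 1 ≤ r) :
    IsSimpleGroup (evenSubgroup q r) where
  exists_pair_ne := by
    obtain ⟨u, v, w, huv, huw, hvw⟩ := exists_three_disj (r := r) hq hr
    exact ⟨⟨_, sw_mul_sw_mem huw huv⟩, 1, fun e =>
      sw_mul_sw_ne_one huv huw hvw (congrArg Subtype.val e)⟩
  eq_bot_or_eq_top_of_normal N hN := by
    rw [or_iff_not_imp_left, Subgroup.eq_bot_iff_forall]
    intro hne
    push Not at hne
    obtain ⟨n, hn, hn1⟩ := hne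
    -- The image of `N` in the whole group need not be normal there, but `evenSubgroup` normalizes
    -- it.
    have hle : evenSubgroup q r ≤ N.map (evenSubgroup q r).subtype := by
      refine evenSubgroup_le_of_normalized hq hr ?_
        ⟨n, ⟨n, hn, rfl⟩, fun e => hn1 (Subtype.ext e)⟩
      rintro g hg _ ⟨k, hk, rfl⟩
      exact ⟨_, hN.conj_mem k hk ⟨g, hg⟩, rfl⟩
    refine eq_top_iff.2 fun g _ => ?_
    obtain ⟨k, hk, hkg⟩ := hle g.2
    rwa [← Subtype.ext (a1 := k) (a2 := g) hkg]

end

end HigmanThompson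

theorem mainTheorem2 (q r : ℕ) (hq : 2 ≤ q) (hr : 1 ≤ r) :
    (∃! θ : HigmanThompson.higmanThompsonGroup q r →* ℤˣ, HigmanThompson.IsTheta θ) ∧
    (∀ θ : HigmanThompson.higmanThompsonGroup q r →* ℤˣ, HigmanThompson.IsTheta θ →
      commutator (HigmanThompson.higmanThompsonGroup q r) = θ.ker) ∧
    IsSimpleGroup (commutator (HigmanThompson.higmanThompsonGroup q r)) := by
  have : NeZero q := ⟨by omega⟩
  obtain ⟨θ, hθ⟩ := HigmanThompson.exists_isTheta (r := r) hq
  refine ⟨⟨θ, hθ, fun θ' h => h.eq hθ⟩, fun θ' h => ?_, ?_⟩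
  · rw [h.ker_eq hq, h.commutator_eq hq hr]
  · rw [hθ.commutator_eq hq hr]
    exact HigmanThompson.isSimpleGroup_evenSubgroup hq hr
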